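/- **Setting.** A direct product structure on a space $R$ is a continuous map $[\cdot,\cdot]:R\times R\to R$ with $[x,x]=x$, $[[x,y],z]=[x,z]=[x,[y,z]]$; its plaques are $P_1(R,x)=\{y:[x,y]=x\}$ and $P_2(R,x)=\{y:[x,y]=y\}$. A local product structure on $\mathcal X$ is a covering by open sets with direct product structures (rectangles) such that, for any two of them, every point of $\mathcal X$ has a neighbourhood on which the two products agree wherever both are defined; an open set with a direct product structure is a rectangle of $\mathcal X$ if it may be added to the covering. A continuous map preserves local product structures if every point of its domain has a rectangular neighbourhood that is mapped onto a rectangle, the map respecting the products. A Smale space is a compact metrizable space $\mathcal X$ with a homeomorphism $f$ preserving a local product structure such that, for some metric $d$ defining the topology and some $\lambda\in(0,1)$, $C>0$, every point has a rectangular neighbourhood $R$ such that, for all $n\ge 0$ and $u\in R$, $d(f^n(y),f^n(z))\le C\lambda^n d(y,z)$ for $y,z\in P_1(R,u)$ and $d(f^{-n}(y),f^{-n}(z))\le C\lambda^n d(y,z)$ for $y,z\in P_2(R,u)$. The stable (unstable) leaf $W_+(x)$ ($W_-(x)$) of $x$ is the set of $y$ with $d(f^n(x),f^n(y))\to0$ as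 $n\to+\infty$ ($n\to-\infty$). Leaves carry their internal topology: for a closed symmetric neighbourhood $U$ of the diagonal such that $(f^n(x),f^n(y))\in U$ for all $n\in\mathbb Z$ implies $x=y$, a neighbourhood basis of $y$ in its stable (unstable) leaf consists of the sets of $z$ with $(f^k(y),f^k(z))\in U$ for all $k\ge -n$ (for all $k\le n$), $n\in\mathbb Z$. A splitting of $(\mathcal X,f)$ is a covering map $\pi:\mathcal M\to\mathcal X$ that preserves the local product structures, where $\mathcal M$ has a global direct product structure, and that restricts for every $x\in\mathcal M$ to homeomorphisms $P_1(\mathcal M,x)\to W_+(\pi(x))$ and $P_2(\mathcal M,x)\to W_-(\pi(x))$. Its group of deck transformations $G$ consists of the homeomorphisms $g$ of $\mathcal M$ preserving the direct product structure with $\pi\circ g=\pi$. A lift of $f$ is a homeomorphism $F$ of $\mathcal M$ preserving the direct product structure with $\pi\circ F=f\circ\pi$; it induces the automorphism $\phi(g)=FgF^{-1}$ of $G$. If $F(x_0)=x_0$, a set $\Sigma\subset G$ is a coarse stable (unstable) plaque of $x_0$ if $\Sigma(x_0)$ and $P_1(\mathcal M,x_0)$ (respectively $P_2(\mathcal M,x_0)$)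 are at finite Hausdorff distance from each other for a $G$-invariant proper metric defining the topology of $\mathcal M$. **Theorem.** Let $(\mathcal X_i,f_i)$, $i=1,2$, be Smale spaces with $\mathcal X_i$ connected and locally connected, $\pi_i:\mathcal M_i\to\mathcal X_i$ splittings with groups of deck transformations $G_i$, $F_i$ lifts of $f_i$ with fixed points $x_i\in\mathcal M_i$, $\phi_i$ the induced automorphisms of $G_i$, and $\Sigma_{i,+},\Sigma_{i,-}\subset G_i$ coarse stable and unstable plaques of $x_i$. If there is a group isomorphism $\psi:G_1\to G_2$ with $\psi\circ\phi_1=\phi_2\circ\psi$, $\psi(\Sigma_{1,+})=\Sigma_{2,+}$ and $\psi(\Sigma_{1,-})=\Sigma_{2,-}$, then $(\mathcal X_1,f_1)$ and $(\mathcal X_2,f_2)$ are topologically conjugate: there is a homeomorphism $h:\mathcal X_1\to\mathcal X_2$ with $h\circ f_1=f_2\circ h$. -/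

import Mathlib

open Filter Topology Set

/-- An open subset `carrier` of `X` with a direct product structure `[x, y] = br x y` on it.
Only the values of `br` on `carrier × carrier` are meaningful. -/
structure Rectangle (X : Type*) [TopologicalSpace X] where
  carrier : Set X
  br : X → X → X
  isOpen_carrier : IsOpen carrier
  br_mem : ∀ x ∈ carrier, ∀ y ∈ carrier, br x y ∈ carrier
  continuousOn_br : ContinuousOn (fun p : X × X => br p.1 p.2) (carrier ×ˢ carrier)
  br_self : ∀ x ∈ carrier, br x x = x
  br_br_left : ∀ x ∈ carrier, ∀ y ∈ carrier, ∀ z ∈ carrier, br (br x y) z = br x z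
  br_br_right : ∀ x ∈ carrier, ∀ y ∈ carrier, ∀ z ∈ carrier, br x (br y z) = br x z

namespace Rectangle

variable {X : Type*} [TopologicalSpace X]

/-- The plaque `P₁(R, x)`; it is `A × {b}` for `R = A × B`, `x = (a, b)`. -/
def plaque₁ (R : Rectangle X) (x : X) : Set X := {y | y ∈ R.carrier ∧ R.br x y = x}

/-- The plaque `P₂(R, x)`; it is `{a} × B` for `R = A × B`, `x = (a, b)`. -/
def plaque₂ (R : Rectangle X) (x : X) : Set X := {y | y ∈ R.carrier ∧ R.br x y = y}

/-- Every point of the space has a neighbourhood on which the two products agree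
(wherever both are defined). -/
def Compatible (R S : Rectangle X) : Prop :=
  ∀ x : X, ∃ U ∈ 𝓝 x, ∀ y ∈ U ∩ R.carrier ∩ S.carrier, ∀ z ∈ U ∩ R.carrier ∩ S.carrier,
    R.br y z = S.br y z

end Rectangle

/-- A local product structure: a covering by pairwise compatible open rectangles. -/
structure LocalProductStructure (X : Type*) [TopologicalSpace X] where
  rects : Set (Rectangle X)
  covers : ∀ x : X, ∃ R ∈ rects, x ∈ R.carrier
  compatible : ∀ R ∈ rects, ∀ S ∈ rects, R.Compatible S

/-- `R` is a (sub-)rectangle of the space with the local product structure `L`: adding `R` to the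
covering defining `L` keeps the compatibility condition. -/
def LocalProductStructure.IsSubrectangle {X : Type*} [TopologicalSpace X]
    (L : LocalProductStructure X) (R : Rectangle X) : Prop :=
  ∀ S ∈ L.rects, R.Compatible S

/-- The continuous map `f` preserves the local product structures. -/
def PreservesLocalProduct {X Y : Type*} [TopologicalSpace X] [TopologicalSpace Y]
    (L : LocalProductStructure X) (L' : LocalProductStructure Y) (f : X → Y) : Prop :=
  Continuous f ∧ ∀ x : X, ∃ R : Rectangle X, L.IsSubrectangle R ∧ x ∈ R.carrier ∧
    ∃ S : Rectangle Y, L'.IsSubrectangle S ∧ S.carrier = f '' R.carrier ∧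
      ∀ y ∈ R.carrier, ∀ z ∈ R.carrier, f (R.br y z) = S.br (f y) (f z)

/-- `(X, f)` is a Smale space with the local product structure `L`: `X` is compact metrizable, `f`
preserves `L`, and for some metric defining the topology `f` uniformly contracts the plaques `P₁`
while `f⁻¹` uniformly contracts the plaques `P₂` of small rectangles. -/
structure IsSmaleSpace {X : Type*} [t : TopologicalSpace X] (f : X ≃ₜ X)
    (L : LocalProductStructure X) : Prop where
  compact : CompactSpace X
  preserves : PreservesLocalProduct L L f
  hyperbolic : ∃ m : MetricSpace X,
    m.toUniformSpace.toTopologicalSpace = t ∧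
    ∃ lam C : ℝ, 0 < lam ∧ lam < 1 ∧ 0 < C ∧
      ∀ x : X, ∃ R : Rectangle X, L.IsSubrectangle R ∧ x ∈ R.carrier ∧ ∀ u ∈ R.carrier,
        (∀ n : ℕ, ∀ y ∈ R.plaque₁ u, ∀ z ∈ R.plaque₁ u,
          m.dist ((f ^ n) y) ((f ^ n) z) ≤ C * lam ^ n * m.dist y z) ∧
        (∀ n : ℕ, ∀ y ∈ R.plaque₂ u, ∀ z ∈ R.plaque₂ u,
          m.dist ((f⁻¹ ^ n) y) ((f⁻¹ ^ n) z) ≤ C * lam ^ n * m.dist y z)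

section Leaves

variable {X : Type*} [TopologicalSpace X]

/-- The stable leaf of `x`: the points `y` such that `fⁿ(x)` and `fⁿ(y)` become arbitrarily close
as `n → +∞`, i.e. `(fⁿ(x), fⁿ(y))` eventually enters every neighbourhood of the diagonal (for
compact `X` these are the entourages, so this says `d(fⁿ(x), fⁿ(y)) → 0` for any metric `d`).
The unstable leaf of `x` with respect to `f` is `stableLeaf f⁻¹ x`. -/
def stableLeaf (f : X ≃ₜ X) (x : X) : Set X :=
  {y | Tendsto (fun n : ℕ => ((f ^ n) x, (f ^ n) y)) atTop (𝓝ˢ (diagonal X))}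

/-- `U` is a closed symmetric neighbourhood of the diagonal witnessing that `f` is expansive. -/
structure IsExpansiveNhd (f : X ≃ₜ X) (U : Set (X × X)) : Prop where
  isClosed : IsClosed U
  mem_nhds : U ∈ 𝓝ˢ (diagonal X)
  symm : ∀ x y, (x, y) ∈ U → (y, x) ∈ U
  expansive : ∀ x y, (∀ n : ℤ, ((f ^ n) x, (f ^ n) y) ∈ U) → x = y

/-- The points `y` such that `(fᵏ(x), fᵏ(y)) ∈ U` for all `k ≥ -n`. For stably equivalent `x, y`
this is the condition `ℓ₊(x, y) ≥ n` on the internal log-scale of the leaf. -/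
def stableBall (f : X ≃ₜ X) (U : Set (X × X)) (n : ℤ) (x : X) : Set X :=
  {y | ∀ k : ℤ, -n ≤ k → ((f ^ k) x, (f ^ k) y) ∈ U}

/-- The stable leaf of `x` as a space with the internal topology, in which the sets
`{z | ℓ₊(y, z) ≥ n}` form a basis of neighbourhoods of `y`. The unstable leaf of `x` with its
internal topology is `StableLeafSpace f⁻¹ U x`. -/
def StableLeafSpace (f : X ≃ₜ X) (_U : Set (X × X)) (x : X) : Type _ := {y : X // y ∈ stableLeaf f x}

instance (f : X ≃ₜ X) (U : Set (X × X)) (x : X) : TopologicalSpace (StableLeafSpace f U x) where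
  IsOpen O := ∀ y ∈ O, ∃ n : ℤ, ∀ z : StableLeafSpace f U x,
    z.val ∈ stableBall f U n y.val → z ∈ O
  isOpen_univ := fun _ _ => ⟨0, fun _ _ => mem_univ _⟩
  isOpen_inter := by
    intro O O' h h' y hy
    obtain ⟨n, hn⟩ := h y hy.1
    obtain ⟨n', hn'⟩ := h' y hy.2
    refine ⟨max n n', fun z hz => ⟨hn z fun k hk => hz k ?_, hn' z fun k hk => hz k ?_⟩⟩
    · have := le_max_left n n'
      omega
    · have := le_max_right n n'
      omega
  isOpen_sUnion := by
    intro S h y hy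
    obtain ⟨O, hO, hyO⟩ := hy
    obtain ⟨n, hn⟩ := h O hO y hyO
    exact ⟨n, fun z hz => ⟨O, hO, hn z hz⟩⟩

end Leaves

/-- A (global) direct product structure on a topological space `M`. -/
structure DirectProductStructure (M : Type*) [TopologicalSpace M] where
  br : M → M → M
  continuous_br : Continuous fun p : M × M => br p.1 p.2
  br_self : ∀ x, br x x = x
  br_br_left : ∀ x y z, br (br x y) z = br x z
  br_br_right : ∀ x y z, br x (br y z) = br x z

namespace DirectProductStructure

variable {M : Type*} [TopologicalSpace M] (D : DirectProductStructure M)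

/-- The plaque `P₁(M, x)`. -/
def plaque₁ (x : M) : Set M := {y | D.br x y = x}

/-- The plaque `P₂(M, x)`. -/
def plaque₂ (x : M) : Set M := {y | D.br x y = y}

/-- The whole space as a rectangle. -/
def toRectangle : Rectangle M where
  carrier := univ
  br := D.br
  isOpen_carrier := isOpen_univ
  br_mem := fun _ _ _ _ => mem_univ _
  continuousOn_br := D.continuous_br.continuousOn
  br_self := fun x _ => D.br_self x
  br_br_left := fun x _ y _ z _ => D.br_br_left x y z
  br_br_right := fun x _ y _ z _ => D.br_br_right x y z

/-- The local product structure defined by the covering of `M` by the single rectangle `M`. -/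
def toLocalProductStructure : LocalProductStructure M where
  rects := {D.toRectangle}
  covers := fun x => ⟨D.toRectangle, rfl, mem_univ x⟩
  compatible := by
    rintro R rfl S rfl x
    exact ⟨univ, univ_mem, fun _ _ _ _ => rfl⟩

end DirectProductStructure

/-- `p : M → X` is a splitting of the Smale space `(X, f)` with local product structure `L`, where
`M` carries the global direct product structure `D`: a covering map agreeing with the local product
structures, whose restrictions to the plaques `P₁` and `P₂` are homeomorphisms onto the stable,
respectively unstable, leaves with their internal topology. -/
structure IsSplitting {X M : Type*} [TopologicalSpace X] [TopologicalSpace M] (f : X ≃ₜ X)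
    (L : LocalProductStructure X) (D : DirectProductStructure M) (p : M → X) : Prop where
  isCoveringMap : IsCoveringMap p
  surjective : Function.Surjective p
  preserves : PreservesLocalProduct D.toLocalProductStructure L p
  leaves : ∃ U : Set (X × X), IsExpansiveNhd f U ∧ ∀ x : M,
    (∃ h : D.plaque₁ x ≃ₜ StableLeafSpace f U (p x), ∀ y : D.plaque₁ x, (h y).val = p y) ∧
    (∃ h : D.plaque₂ x ≃ₜ StableLeafSpace f⁻¹ U (p x), ∀ y : D.plaque₂ x, (h y).val = p y)

section Deck

variable {X M : Type*} [TopologicalSpace X] [TopologicalSpace M]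

/-- The group of deck transformations: homeomorphisms of `M` over `X` that preserve the direct
product structure. -/
def deckGroup (D : DirectProductStructure M) (p : M → X) : Subgroup (M ≃ₜ M) where
  carrier := {g | (∀ x y, g (D.br x y) = D.br (g x) (g y)) ∧ ∀ x, p (g x) = p x}
  mul_mem' := by
    rintro a b ⟨ha, ha'⟩ ⟨hb, hb'⟩
    exact ⟨fun x y => by rw [Homeomorph.mul_apply, hb, ha]; rfl,
      fun x => by rw [Homeomorph.mul_apply, ha', hb']⟩
  one_mem' := ⟨fun _ _ => rfl, fun _ => rfl⟩
  inv_mem' := by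
    rintro a ⟨ha, ha'⟩
    have key : ∀ x, a (a⁻¹ x) = x := fun x => a.apply_symm_apply x
    refine ⟨fun x y => a.injective ?_, fun x => ?_⟩
    · rw [ha, key, key, key]
    · rw [← ha', key]

/-- `F` is a lift of `f` to `M`: a homeomorphism preserving the direct product structure with
`p ∘ F = f ∘ p`. -/
structure IsLift (f : X ≃ₜ X) (D : DirectProductStructure M) (p : M → X) (F : M ≃ₜ M) : Prop where
  map_br : ∀ x y, F (D.br x y) = D.br (F x) (F y)
  semiconj : ∀ x, p (F x) = f (p x)

theorem IsLift.conj_mem {f : X ≃ₜ X} {D : DirectProductStructure M} {p : M → X} {F : M ≃ₜ M}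
    (hF : IsLift f D p F) {g : M ≃ₜ M} (hg : g ∈ deckGroup D p) :
    F * g * F⁻¹ ∈ deckGroup D p := by
  have key : ∀ x, F (F⁻¹ x) = x := fun x => F.apply_symm_apply x
  have hinv : ∀ x y, F⁻¹ (D.br x y) = D.br (F⁻¹ x) (F⁻¹ y) := fun x y =>
    F.injective (by rw [hF.map_br, key, key, key])
  refine ⟨fun x y => ?_, fun x => ?_⟩
  · simp only [Homeomorph.mul_apply]
    rw [hinv, hg.1, hF.map_br]
  · simp only [Homeomorph.mul_apply]
    rw [hF.semiconj, hg.2, ← hF.semiconj, key]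

theorem IsLift.inv_conj_mem {f : X ≃ₜ X} {D : DirectProductStructure M} {p : M → X} {F : M ≃ₜ M}
    (hF : IsLift f D p F) {g : M ≃ₜ M} (hg : g ∈ deckGroup D p) :
    F⁻¹ * g * F ∈ deckGroup D p := by
  have key : ∀ x, F (F⁻¹ x) = x := fun x => F.apply_symm_apply x
  have hinv : ∀ x y, F⁻¹ (D.br x y) = D.br (F⁻¹ x) (F⁻¹ y) := fun x y =>
    F.injective (by rw [hF.map_br, key, key, key])
  refine ⟨fun x y => ?_, fun x => f.injective ?_⟩
  · simp only [Homeomorph.mul_apply]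
    rw [hF.map_br, hg.1, hinv]
  · simp only [Homeomorph.mul_apply]
    rw [← hF.semiconj, key, hg.2, hF.semiconj]

/-- The automorphism `φ` of the group of deck transformations associated with the lift `F`:
`φ(g) = F ∘ g ∘ F⁻¹`, i.e. `F(g(x)) = φ(g)(F(x))`. -/
def inducedAut {f : X ≃ₜ X} {D : DirectProductStructure M} {p : M → X} {F : M ≃ₜ M}
    (hF : IsLift f D p F) : deckGroup D p ≃* deckGroup D p where
  toFun g := ⟨F * g * F⁻¹, hF.conj_mem g.2⟩
  invFun g := ⟨F⁻¹ * g * F, hF.inv_conj_mem g.2⟩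
  left_inv g := by
    apply Subtype.ext
    simp [mul_assoc]
  right_inv g := by
    apply Subtype.ext
    simp [mul_assoc]
  map_mul' g h := by
    apply Subtype.ext
    simp [mul_assoc]

/-- A metric on `M` by which coarse distances are measured: it defines the topology of `M`, is
invariant under deck transformations, and its closed balls are compact. (The group of deck
transformations of a splitting of a connected and locally connected Smale space acts cocompactly,
so any two such metrics are coarsely equivalent.) -/
structure IsInvariantProperMetric {X M : Type*} [TopologicalSpace X] [t : TopologicalSpace M]
    (D : DirectProductStructure M) (p : M → X) (m : MetricSpace M) : Prop where
  topology_eq : m.toUniformSpace.toTopologicalSpace = t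
  proper : @ProperSpace M m.toPseudoMetricSpace
  invariant : ∀ g ∈ deckGroup D p, ∀ x y : M, m.dist (g x) (g y) = m.dist x y

/-- The sets `A` and `B` are on a finite Hausdorff distance from each other for the metric `m`. -/
def FiniteHausdorffDist (m : MetricSpace M) (A B : Set M) : Prop :=
  ∃ r : ℝ, (∀ a ∈ A, ∃ b ∈ B, m.dist a b < r) ∧ (∀ b ∈ B, ∃ a ∈ A, m.dist a b < r)

/-- The orbit `S(x) = {g(x) | g ∈ S}` for a set `S` of deck transformations. -/
def partialOrbit (D : DirectProductStructure M) (p : M → X) (S : Set (deckGroup D p))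
    (x : M) : Set M := (fun g : deckGroup D p => (g : M ≃ₜ M) x) '' S

/-- `S` is a coarse stable plaque of `x`. -/
def IsCoarseStablePlaque (D : DirectProductStructure M) (p : M → X) (x : M)
    (S : Set (deckGroup D p)) : Prop :=
  ∃ m : MetricSpace M, IsInvariantProperMetric D p m ∧
    FiniteHausdorffDist m (partialOrbit D p S x) (D.plaque₁ x)

/-- `S` is a coarse unstable plaque of `x`. -/
def IsCoarseUnstablePlaque (D : DirectProductStructure M) (p : M → X) (x : M)
    (S : Set (deckGroup D p)) : Prop :=
  ∃ m : MetricSpace M, IsInvariantProperMetric D p m ∧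
    FiniteHausdorffDist m (partialOrbit D p S x) (D.plaque₂ x)

end Deck

/-!
Since the deck groups act cocompactly and properly, an isomorphism `ψ` between them is a coarse
equivalence of the covering spaces `M₁` and `M₂`. The proof turns it into a homeomorphism of `M₁`
onto `M₂` that is equivariant for the deck groups and for the lifts, and hence descends to a
conjugacy.

Say that `m` corresponds to `m'` if one sequence `gₙ` of deck transformations satisfies
`gₙ x₁ ≈ F₁ⁿ m` and `ψ(gₙ) x₂ ≈ F₂ⁿ m'` for all integers `n`, up to an error independent of `n`
(`Corresponds`). Bounded orbits are unique: the lift contracts the plaques `P₁` and expands the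
plaques `P₂` uniformly on bounded scales, and the bracket is bornologous, so a point is determined
by its orbit up to a bounded error (`HyperbolicSplitting.eq_of_bounded`). Therefore every point
corresponds to at most one point, and the correspondence automatically commutes with everything
(`SplittingIsomorphism.corresponds_deck`, `Corresponds.lift`).

Existence is where the coarse plaques enter. For `m` in the stable plaque of `x₁` the whole orbit
stays in this plaque, so `ψ(gₙ) x₂` may be replaced by a pseudo-orbit inside the stable plaque of
`x₂`, which is shadowed by an orbit because the lift contracts the plaque
(`HyperbolicSplitting.exists_shadow₁`). The same holds for unstable plaques. An arbitrary point is
a bracket `[y, z]` with `y` in the stable and `z` in the unstable plaque of `x₁`; its orbit follows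
that of `z` in forward time and that of `y` in backward time, hence it corresponds to the bracket
of the points corresponding to `y` and `z` (`HyperbolicSplitting.corresponds_br`). On the two
plaques the errors are uniform, which gives continuity.

Two facts about the splitting itself are needed. Plaques are connected, because two points of a
plaque are brought by the dynamics into a common connected chart
(`HyperbolicSplitting.isPreconnected_plaque₁`). And the deck transformations act transitively on
the fibres (`HyperbolicSplitting.exists_deck_apply_eq`): the product of the two homeomorphisms
between plaques given by the leaves covers the identity by a connectedness argument. The latter
yields cocompactness, from which all uniform estimates follow.
-/


/-! ### Exchanging the two directions of a product -/

/-- The rectangle with the two factors exchanged. -/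
def Rectangle.swap {X : Type*} [TopologicalSpace X] (R : Rectangle X) : Rectangle X where
  carrier := R.carrier
  br x y := R.br y x
  isOpen_carrier := R.isOpen_carrier
  br_mem x hx y hy := R.br_mem y hy x hx
  continuousOn_br :=
    R.continuousOn_br.comp continuous_swap.continuousOn fun _ h => ⟨h.2, h.1⟩
  br_self := R.br_self
  br_br_left x hx y hy z hz := R.br_br_right z hz y hy x hx
  br_br_right x hx y hy z hz := R.br_br_left z hz y hy x hx

namespace Rectangle

variable {X : Type*} [TopologicalSpace X] (R : Rectangle X)

theorem br_eq_right_iff {u v : X} (hu : u ∈ R.carrier) (hv : v ∈ R.carrier) :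
    R.br u v = v ↔ R.br v u = u := by
  constructor <;> intro h
  · rw [← h, R.br_br_left u hu v hv u hu, R.br_self u hu]
  · rw [← h, R.br_br_left v hv u hu v hv, R.br_self v hv]

theorem br_eq_left_iff {u v : X} (hu : u ∈ R.carrier) (hv : v ∈ R.carrier) :
    R.br u v = u ↔ R.br v u = v := by
  constructor <;> intro h
  · rw [← h, R.br_br_right v hv u hu v hv, R.br_self v hv]
  · rw [← h, R.br_br_right u hu v hv u hu, R.br_self u hu]

theorem swap_plaque₁ {u : X} (hu : u ∈ R.carrier) : R.swap.plaque₁ u = R.plaque₂ u := by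
  ext v
  exact and_congr_right fun hv => R.br_eq_right_iff hv hu

end Rectangle

namespace DirectProductStructure

variable {M : Type*} [TopologicalSpace M] (D : DirectProductStructure M)

/-- The direct product structure with the two factors exchanged. -/
def swap : DirectProductStructure M where
  br x y := D.br y x
  continuous_br := D.continuous_br.comp continuous_swap
  br_self := D.br_self
  br_br_left x y z := D.br_br_right z y x
  br_br_right x y z := D.br_br_left z y x

theorem br_eq_right_iff {x y : M} : D.br x y = y ↔ D.br y x = x := by
  constructor <;> intro h
  · rw [← h, D.br_br_left, D.br_self]
  · rw [← h, D.br_br_left, D.br_self]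

theorem br_eq_left_iff {x y : M} : D.br x y = x ↔ D.br y x = y := by
  constructor <;> intro h
  · rw [← h, D.br_br_right, D.br_self]
  · rw [← h, D.br_br_right, D.br_self]

theorem swap_plaque₁ (x : M) : D.swap.plaque₁ x = D.plaque₂ x := by
  ext y
  exact D.br_eq_right_iff

theorem swap_plaque₂ (x : M) : D.swap.plaque₂ x = D.plaque₁ x := by
  ext y
  exact D.br_eq_left_iff.symm

theorem br_left_trans {x y z : M} (h : D.br x y = x) (h' : D.br y z = y) : D.br x z = x := by
  rw [← D.br_br_right x y z, h', h]

/-- `m ↦ [m, x]` is a retraction of the whole space onto `P₁(M, x)`. -/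
theorem br_mem_plaque₁ (m x : M) : D.br x (D.br m x) = x := by
  rw [D.br_br_right, D.br_self]

theorem br_br_br_br (a b c d : M) : D.br (D.br a b) (D.br c d) = D.br a d := by
  rw [D.br_br_left, D.br_br_right]

/-- Every point is the bracket of its projections to the two plaques of `x`. -/
theorem br_proj (m x : M) : D.br (D.br m x) (D.br x m) = m := by
  rw [D.br_br_br_br, D.br_self]

end DirectProductStructure

theorem mem_deckGroup_swap {X M : Type*} [TopologicalSpace X] [TopologicalSpace M]
    {D : DirectProductStructure M} {p : M → X} {g : M ≃ₜ M} :
    g ∈ deckGroup D.swap p ↔ g ∈ deckGroup D p :=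
  ⟨fun h => ⟨fun x y => h.1 y x, h.2⟩, fun h => ⟨fun x y => h.1 y x, h.2⟩⟩

section Lift

variable {X M : Type*} [TopologicalSpace X] [TopologicalSpace M] {f : X ≃ₜ X}
  {D : DirectProductStructure M} {p : M → X} {F : M ≃ₜ M}

theorem IsLift.inv (hF : IsLift f D p F) : IsLift f⁻¹ D p F⁻¹ where
  map_br x y := F.injective (by
    have key : ∀ x, F (F⁻¹ x) = x := fun x => F.apply_symm_apply x
    rw [hF.map_br, key, key, key])
  semiconj x := f.injective (by
    have key : ∀ x, F (F⁻¹ x) = x := fun x => F.apply_symm_apply x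
    have key' : ∀ x, f (f⁻¹ x) = x := fun x => f.apply_symm_apply x
    rw [← hF.semiconj, key, key'])

theorem IsLift.swap (hF : IsLift f D p F) : IsLift f D.swap p F :=
  ⟨fun x y => hF.map_br y x, hF.semiconj⟩

theorem IsLift.pow (hF : IsLift f D p F) (n : ℕ) : IsLift (f ^ n) D p (F ^ n) := by
  induction n with
  | zero => exact ⟨fun _ _ => rfl, fun _ => rfl⟩
  | succ n ih =>
    refine ⟨fun x y => ?_, fun x => ?_⟩
    · simp only [pow_succ, Homeomorph.mul_apply, hF.map_br, ih.map_br]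
    · simp only [pow_succ, Homeomorph.mul_apply, ih.semiconj, hF.semiconj]

theorem IsLift.zpow (hF : IsLift f D p F) (n : ℤ) : IsLift (f ^ n) D p (F ^ n) := by
  obtain ⟨n, rfl | rfl⟩ := n.eq_nat_or_neg
  · simpa only [zpow_natCast] using hF.pow n
  · simpa only [zpow_neg, zpow_natCast] using (hF.pow n).inv

end Lift

/-! ### Charts and splittings -/

/-- `R` is a connected rectangle of the base on which the covering `p` respects the products and
the iterates of `f` (of `f⁻¹`) are uniformly `C`-Lipschitz on the plaques `P₁` (on the plaques
`P₂`). -/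
structure IsProductChart {X M : Type*} [MetricSpace X] [TopologicalSpace M] (f : X ≃ₜ X)
    (D : DirectProductStructure M) (p : M → X) (C : ℝ) (R : Rectangle X) : Prop where
  isPreconnected : IsPreconnected R.carrier
  map_br : ∀ a, p a ∈ R.carrier →
    ∀ᶠ q in 𝓝 (a, a), p (D.br q.1 q.2) = R.br (p q.1) (p q.2)
  dist_le₁ : ∀ u ∈ R.carrier, ∀ n : ℕ, ∀ y ∈ R.plaque₁ u, ∀ z ∈ R.plaque₁ u,
    dist ((f ^ n) y) ((f ^ n) z) ≤ C * dist y z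
  dist_le₂ : ∀ u ∈ R.carrier, ∀ n : ℕ, ∀ y ∈ R.plaque₂ u, ∀ z ∈ R.plaque₂ u,
    dist ((f⁻¹ ^ n) y) ((f⁻¹ ^ n) z) ≤ C * dist y z

/-- A splitting of a locally connected Smale space with a lift `F` of the dynamics, as it is used
below. The conditions on the two directions are interchanged by `f ↦ f⁻¹`, so that every statement
about plaques `P₁` yields one about plaques `P₂`. -/
structure HyperbolicSplitting {X M : Type*} [MetricSpace X] [MetricSpace M] (f : X ≃ₜ X)
    (D : DirectProductStructure M) (p : M → X) (F : M ≃ₜ M) : Prop where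
  isCoveringMap : IsCoveringMap p
  surjective : Function.Surjective p
  isLift : IsLift f D p F
  dist_deck : ∀ g ∈ deckGroup D p, ∀ x y : M, dist (g x) (g y) = dist x y
  expansive : ∃ ε > 0, ∀ x y : X, (∀ n : ℤ, dist ((f ^ n) x) ((f ^ n) y) ≤ ε) → x = y
  injOn₁ : ∀ a b b', D.br a b = a → D.br a b' = a → p b = p b' → b = b'
  injOn₂ : ∀ a b b', D.br a b = b → D.br a b' = b' → p b = p b' → b = b'
  asymptotic₁ : ∀ a b, D.br a b = a →
    Tendsto (fun n : ℕ => dist ((f ^ n) (p a)) ((f ^ n) (p b))) atTop (𝓝 0)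
  asymptotic₂ : ∀ a b, D.br a b = b →
    Tendsto (fun n : ℕ => dist ((f⁻¹ ^ n) (p a)) ((f⁻¹ ^ n) (p b))) atTop (𝓝 0)
  holonomy₁ : ∀ a a', p a = p a' → ∃ h : D.plaque₁ a ≃ₜ D.plaque₁ a', ∀ y, p (h y) = p y
  holonomy₂ : ∀ a a', p a = p a' → ∃ h : D.plaque₂ a ≃ₜ D.plaque₂ a', ∀ y, p (h y) = p y
  charts : ∃ C : ℝ, 0 < C ∧ ∀ x, ∀ O ∈ 𝓝 x, ∃ R : Rectangle X,
    IsProductChart f D p C R ∧ x ∈ R.carrier ∧ R.carrier ⊆ O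

section Swap

variable {X M : Type*} [MetricSpace X] [MetricSpace M] {f : X ≃ₜ X}
  {D : DirectProductStructure M} {p : M → X} {F : M ≃ₜ M}

theorem IsProductChart.swap {C : ℝ}
    {R : Rectangle X} (h : IsProductChart f D p C R) : IsProductChart f⁻¹ D.swap p C R.swap where
  isPreconnected := h.isPreconnected
  map_br a ha := by
    have := h.map_br a ha
    exact (continuous_swap.tendsto (a, a)).eventually this
  dist_le₁ u hu := by
    rw [R.swap_plaque₁ hu]
    exact h.dist_le₂ u hu
  dist_le₂ u hu := by
    rw [← R.swap.swap_plaque₁ hu, inv_inv]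
    exact h.dist_le₁ u hu

theorem HyperbolicSplitting.swap (h : HyperbolicSplitting f D p F) :
    HyperbolicSplitting f⁻¹ D.swap p F⁻¹ where
  isCoveringMap := h.isCoveringMap
  surjective := h.surjective
  isLift := h.isLift.inv.swap
  dist_deck g hg := h.dist_deck g (mem_deckGroup_swap.1 hg)
  expansive := by
    obtain ⟨ε, hε, H⟩ := h.expansive
    refine ⟨ε, hε, fun x y hxy => H x y fun n => ?_⟩
    simpa using hxy (-n)
  injOn₁ a b b' hb hb' := h.injOn₂ a b b' (D.br_eq_right_iff.1 hb) (D.br_eq_right_iff.1 hb')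
  injOn₂ a b b' hb hb' := h.injOn₁ a b b' (D.br_eq_left_iff.1 hb) (D.br_eq_left_iff.1 hb')
  asymptotic₁ a b hab := h.asymptotic₂ a b (D.br_eq_right_iff.1 hab)
  asymptotic₂ a b hab := by
    rw [inv_inv]
    exact h.asymptotic₁ a b (D.br_eq_left_iff.1 hab)
  holonomy₁ a a' haa' := by
    rw [D.swap_plaque₁, D.swap_plaque₁]
    exact h.holonomy₂ a a' haa'
  holonomy₂ a a' haa' := by
    rw [D.swap_plaque₂, D.swap_plaque₂]
    exact h.holonomy₁ a a' haa'
  charts := by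
    obtain ⟨C, hC, H⟩ := h.charts
    refine ⟨C, hC, fun x O hO => ?_⟩
    obtain ⟨R, hR, hx, hRO⟩ := H x O hO
    exact ⟨R.swap, hR.swap, hx, hRO⟩

end Swap

/-! ### Sections of the covering over charts -/

/-- A neighbourhood `O` of `x` is evenly covered: through every point `a` over `O` there passes a
section over `O`, whose image contains a neighbourhood of `a`. -/
theorem IsCoveringMap.exists_sections {X M : Type*} [TopologicalSpace X] [TopologicalSpace M]
    {p : M → X} (hp : IsCoveringMap p) (x : X) :
    ∃ O ∈ 𝓝 x, ∀ a, p a ∈ O → ∃ s : X → M, ContinuousOn s O ∧ s (p a) = a ∧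
      (∀ v ∈ O, p (s v) = v) ∧ ∀ᶠ m in 𝓝 a, s (p m) = m := by
  classical
  obtain ⟨hI, U, hxU, hU, hpU, H, hH⟩ := hp x
  refine ⟨U, hU.mem_nhds hxU, fun a ha => ?_⟩
  set c := (H ⟨a, ha⟩).2 with hc
  have key : ∀ m (hm : p m ∈ U), (H ⟨m, hm⟩).2 = c → H.symm (⟨p m, hm⟩, c) = ⟨m, hm⟩ := by
    intro m hm h
    rw [Homeomorph.symm_apply_eq, ← h]
    exact Prod.ext (Subtype.ext (hH ⟨m, hm⟩).symm) rfl
  refine ⟨fun v => if hv : v ∈ U then (H.symm (⟨v, hv⟩, c)).1 else a, ?_, ?_, ?_, ?_⟩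
  · rw [continuousOn_iff_continuous_domRestrict]
    have : Continuous fun v : U => (H.symm (v, c)).1 := by fun_prop
    refine this.congr fun v => ?_
    simp [v.2]
  · simp only [ha, dif_pos, key a ha rfl]
  · intro v hv
    simp only [hv, dif_pos]
    have := hH (H.symm (⟨v, hv⟩, c))
    rw [H.apply_symm_apply] at this
    exact this.symm
  · have hcont : Continuous fun m : p ⁻¹' U => (H m).2 := by fun_prop
    have h1 : ∀ᶠ m : p ⁻¹' U in 𝓝 ⟨a, ha⟩, (H m).2 = c :=
      hcont.continuousAt.eventually ((isOpen_discrete {c}).mem_nhds rfl)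
    have h2 := (hpU.isOpenEmbedding_subtypeVal.map_nhds_eq (⟨a, ha⟩ : p ⁻¹' U))
    have h3 : ∀ᶠ m in 𝓝 a, ∃ hm : p m ∈ U, (H ⟨m, hm⟩).2 = c := by
      rw [← h2, eventually_map]
      filter_upwards [h1] with m hm
      exact ⟨m.2, hm⟩
    filter_upwards [h3] with m ⟨hm, hm'⟩
    simp only [hm, dif_pos, key m hm hm']

section

variable {X M : Type*} [MetricSpace X] [MetricSpace M] {f : X ≃ₜ X}
  {D : DirectProductStructure M} {p : M → X} {F : M ≃ₜ M}

namespace HyperbolicSplitting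

/-- Plaques `P₁` of a chart lift to plaques `P₁` of the product. -/
theorem section_plaque₁ (h : HyperbolicSplitting f D p F) {C : ℝ} {R : Rectangle X}
    (hR : IsProductChart f D p C R) {s : X → M} (hs : ContinuousOn s R.carrier)
    (hps : ∀ v ∈ R.carrier, p (s v) = v) {u v : X} (hu : u ∈ R.carrier)
    (hv : v ∈ R.plaque₁ u) : D.br (s u) (s v) = s u := by
  have hsub : R.plaque₁ u ⊆ R.carrier := fun w hw => hw.1
  have himg : R.plaque₁ u = (fun w => R.br w u) '' R.carrier := by
    ext w
    constructor
    · intro hw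
      exact ⟨w, hw.1, (R.br_eq_left_iff hu hw.1).1 hw.2⟩
    · rintro ⟨w, hw, rfl⟩
      exact ⟨R.br_mem _ hw _ hu, by rw [R.br_br_right _ hu _ hw _ hu, R.br_self _ hu]⟩
  have hconn : IsPreconnected (R.plaque₁ u) := by
    rw [himg]
    refine hR.isPreconnected.image _ (R.continuousOn_br.comp (f := fun w => (w, u)) ?_ ?_)
    · fun_prop
    · exact fun w hw => ⟨hw, hu⟩
  refine hconn.induction₂ (fun v w => D.br (s v) (s w) = s v) ?_ ?_ ?_
    (x := u) (y := v) ⟨hu, R.br_self u hu⟩ hv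
  · intro v hv
    have hsv : Tendsto s (𝓝[R.plaque₁ u] v) (𝓝 (s v)) := (hs v (hsub hv)).mono hsub
    have h1 := ((tendsto_const_nhds (x := s v)).prodMk_nhds hsv).eventually
      (hR.map_br (s v) (by rw [hps v (hsub hv)]; exact hsub hv))
    filter_upwards [h1, self_mem_nhdsWithin] with w hw hwu
    have hvw : R.br v w = v := by
      have e1 : R.br v w = R.br v u := by
        have := (R.br_eq_left_iff hu hwu.1).1 hwu.2
        rw [← this, R.br_br_right _ hv.1 _ hwu.1 _ hu]
      rw [e1]
      exact (R.br_eq_left_iff hu hv.1).1 hv.2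
    -- `[s v, s w]` and `s v` lie in the same plaque `P₂` and over the same point.
    refine h.injOn₂ (s v) _ _ ?_ (D.br_self _) ?_
    · rw [D.br_br_right]
    · rw [hw, hps v hv.1, hps w hwu.1, hvw]
  · intro x y z _ _ _ hxy hyz
    exact D.br_left_trans hxy hyz
  · intro x y _ _ hxy
    exact D.br_eq_left_iff.1 hxy

/-- Sections of the covering over charts respect the products globally, although this is known
of the covering only locally. -/
theorem section_br (h : HyperbolicSplitting f D p F) {C : ℝ} {R : Rectangle X}
    (hR : IsProductChart f D p C R) {s : X → M} (hs : ContinuousOn s R.carrier)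
    (hps : ∀ v ∈ R.carrier, p (s v) = v) {u v : X} (hu : u ∈ R.carrier)
    (hv : v ∈ R.carrier) : s (R.br u v) = D.br (s u) (s v) := by
  have h1 : D.br (s v) (s (R.br u v)) = s v :=
    h.section_plaque₁ hR hs hps hv ⟨R.br_mem _ hu _ hv, by
      rw [R.br_br_right _ hv _ hu _ hv, R.br_self _ hv]⟩
  have h2 : D.br (s (R.br u v)) (s u) = s u :=
    h.swap.section_plaque₁ hR.swap hs hps hu ⟨R.br_mem _ hu _ hv, by
      change R.br (R.br u v) u = u
      rw [R.br_br_left _ hu _ hv _ hu, R.br_self _ hu]⟩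
  rw [← D.br_br_right (s u) (s (R.br u v)) (s v), D.br_eq_left_iff.1 h1, D.br_eq_right_iff.2 h2]

/-- If `a` and `b` lie in the same plaque `P₁` and the forward orbits of their images stay close,
then `b` lies on the section through `a` over any small chart containing the images. -/
theorem exists_section_eq (h : HyperbolicSplitting f D p F) {C : ℝ} (hC : 0 < C) :
    ∃ δ > 0, ∀ R : Rectangle X, IsProductChart f D p C R →
      (∀ u ∈ R.carrier, ∀ v ∈ R.carrier, dist u v ≤ δ) →
      ∀ a b, D.br a b = a → (∀ k : ℕ, dist ((f ^ k) (p a)) ((f ^ k) (p b)) ≤ δ) →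
        p a ∈ R.carrier → p b ∈ R.carrier → ∀ s : X → M, ContinuousOn s R.carrier →
          (∀ v ∈ R.carrier, p (s v) = v) → s (p a) = a → s (p b) = b := by
  obtain ⟨ε, hε, hexp⟩ := h.expansive
  refine ⟨ε / (C + 1), by positivity, fun R hR hdiam a b hab hclose ha hb s hs hps hsa => ?_⟩
  set δ := ε / (C + 1) with hδ
  have hδε : C * δ + δ = ε := by rw [hδ]; field_simp
  have hδ0 : 0 < δ := by rw [hδ]; positivity
  -- The bracket `w` stays close to `p a` in backward time and to `p b` in forward time.
  set w := R.br (p a) (p b) with hw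
  have hwR : w ∈ R.carrier := R.br_mem _ ha _ hb
  have hw1 : w ∈ R.plaque₁ (p b) := ⟨hwR, by rw [R.br_br_right _ hb _ ha _ hb, R.br_self _ hb]⟩
  have hw2 : w ∈ R.plaque₂ (p a) := ⟨hwR, by rw [R.br_br_right _ ha _ ha _ hb]⟩
  have hwa : w = p a := by
    refine hexp _ _ fun n => ?_
    obtain ⟨n, rfl | rfl⟩ := n.eq_nat_or_neg
    · rw [zpow_natCast]
      have h1 := hR.dist_le₁ _ hb n w hw1 (p b) ⟨hb, R.br_self _ hb⟩
      have h2 := mul_le_mul_of_nonneg_left (hdiam w hwR _ hb) hC.le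
      have h3 := hclose n
      rw [dist_comm] at h3
      linarith [dist_triangle ((f ^ n) w) ((f ^ n) (p b)) ((f ^ n) (p a))]
    · rw [zpow_neg, zpow_natCast, ← inv_pow]
      have h1 := hR.dist_le₂ _ ha n w hw2 (p a) ⟨ha, R.br_self _ ha⟩
      have h2 := mul_le_mul_of_nonneg_left (hdiam w hwR _ ha) hC.le
      linarith
  have h1 := h.section_br hR hs hps ha hb
  rw [← hw, hwa, hsa] at h1
  exact h.injOn₁ a _ _ h1.symm hab (hps _ hb)

theorem map_zpow (h : HyperbolicSplitting f D p F) (n : ℤ) (x : M) :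
    p ((F ^ n) x) = (f ^ n) (p x) := (h.isLift.zpow n).semiconj x

theorem br_zpow (h : HyperbolicSplitting f D p F) (n : ℤ) (x y : M) :
    (F ^ n) (D.br x y) = D.br ((F ^ n) x) ((F ^ n) y) := (h.isLift.zpow n).map_br x y

theorem br_zpow_eq (h : HyperbolicSplitting f D p F) (n : ℤ) {x y : M} (hxy : D.br x y = x) :
    D.br ((F ^ n) x) ((F ^ n) y) = (F ^ n) x := by rw [← h.br_zpow, hxy]

variable [CompactSpace X]

/-- Plaques `P₁` of the product are connected: two points of a plaque are eventually so close
under the iterates of `F` that they lie on a section over a connected chart. -/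
theorem isPreconnected_plaque₁ (h : HyperbolicSplitting f D p F) (x : M) :
    IsPreconnected (D.plaque₁ x) := by
  obtain ⟨C, hC, hcharts⟩ := h.charts
  obtain ⟨δ, hδ, hkey⟩ := h.exists_section_eq hC
  have hR : ∀ q : X, ∃ R : Rectangle X, IsProductChart f D p C R ∧ q ∈ R.carrier ∧
      (∀ u ∈ R.carrier, ∀ v ∈ R.carrier, dist u v ≤ δ) ∧
      ∀ a, p a ∈ R.carrier → ∃ s : X → M, ContinuousOn s R.carrier ∧ s (p a) = a ∧
        ∀ v ∈ R.carrier, p (s v) = v := by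
    intro q
    obtain ⟨O, hO, hsec⟩ := h.isCoveringMap.exists_sections q
    obtain ⟨R, hR, hq, hRO⟩ := hcharts q (O ∩ Metric.ball q (δ / 2))
      (inter_mem hO (Metric.ball_mem_nhds _ (by positivity)))
    refine ⟨R, hR, hq, fun u hu v hv => ?_, fun a ha => ?_⟩
    · have h1 := Metric.mem_ball.1 (hRO hu).2
      have h2 := Metric.mem_ball.1 (hRO hv).2
      linarith [dist_triangle_right u v q]
    · obtain ⟨s, hs, hsa, hps, -⟩ := hsec a (hRO ha).1
      exact ⟨s, hs.mono fun v hv => (hRO hv).1, hsa, fun v hv => hps v (hRO hv).1⟩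
  choose R hR hmem hdiam hsec using hR
  obtain ⟨η, hη, hleb⟩ := lebesgue_number_lemma_of_metric (s := (univ : Set X))
    (c := fun q => (R q).carrier) isCompact_univ (fun q => (R q).isOpen_carrier)
    (fun q _ => mem_iUnion.2 ⟨q, hmem q⟩)
  refine isPreconnected_of_forall_pair fun y hy z hz => ?_
  have hyz : D.br y z = y := D.br_left_trans (D.br_eq_left_iff.1 hy) hz
  obtain ⟨N, hN⟩ := eventually_atTop.1
    ((h.asymptotic₁ y z hyz).eventually (gt_mem_nhds (lt_min hδ hη)))
  set a := (F ^ (N : ℤ)) y with ha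
  set b := (F ^ (N : ℤ)) z with hb
  have hab : D.br a b = a := h.br_zpow_eq N hyz
  have hpa : p a = (f ^ N) (p y) := by rw [ha, h.map_zpow, zpow_natCast]
  have hpb : p b = (f ^ N) (p z) := by rw [hb, h.map_zpow, zpow_natCast]
  have hclose : ∀ k : ℕ, dist ((f ^ k) (p a)) ((f ^ k) (p b)) < min δ η := by
    intro k
    rw [hpa, hpb, ← Homeomorph.mul_apply, ← Homeomorph.mul_apply, ← pow_add]
    exact hN _ (Nat.le_add_left _ _)
  obtain ⟨q, hq⟩ := hleb (p a) (mem_univ _)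
  have haR : p a ∈ (R q).carrier := hq (Metric.mem_ball_self hη)
  have hbR : p b ∈ (R q).carrier := hq (by
    rw [Metric.mem_ball, dist_comm]
    exact (hclose 0).trans_le (min_le_right _ _))
  obtain ⟨s, hs, hsa, hps⟩ := hsec q a haR
  have hsb : s (p b) = b := hkey (R q) (hR q) (hdiam q) a b hab
    (fun k => (hclose k).le.trans (min_le_left _ _)) haR hbR s hs hps hsa
  -- Pull the image of the section back by `F⁻ᴺ`, after retracting it to the plaque of `Fᴺ x`.
  have hinv : ∀ m, (F ^ (-(N : ℤ))) ((F ^ (N : ℤ)) m) = m := fun m => by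
    rw [← Homeomorph.mul_apply, ← zpow_add, neg_add_cancel]; rfl
  have hval : ∀ m, (F ^ (-(N : ℤ))) (D.br m ((F ^ (N : ℤ)) x)) =
      D.br ((F ^ (-(N : ℤ))) m) x := fun m => by rw [h.br_zpow, hinv]
  refine ⟨(fun v => (F ^ (-(N : ℤ))) (D.br (s v) ((F ^ (N : ℤ)) x))) '' (R q).carrier,
    ?_, ⟨p a, haR, ?_⟩, ⟨p b, hbR, ?_⟩, (hR q).isPreconnected.image _ ?_⟩
  · rintro _ ⟨v, -, rfl⟩
    change D.br x ((F ^ (-(N : ℤ))) (D.br (s v) ((F ^ (N : ℤ)) x))) = x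
    rw [hval, D.br_mem_plaque₁]
  · change (F ^ (-(N : ℤ))) (D.br (s (p a)) ((F ^ (N : ℤ)) x)) = y
    rw [hval, hsa, ha, hinv]
    exact D.br_eq_left_iff.1 hy
  · change (F ^ (-(N : ℤ))) (D.br (s (p b)) ((F ^ (N : ℤ)) x)) = z
    rw [hval, hsb, hb, hinv]
    exact D.br_eq_left_iff.1 hz
  · refine (F ^ (-(N : ℤ))).continuous.comp_continuousOn ?_
    exact D.continuous_br.comp_continuousOn (hs.prodMk continuousOn_const)

end HyperbolicSplitting

end

/-! ### The deck transformations act transitively on the fibres -/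

section

variable {X M : Type*} [MetricSpace X] [MetricSpace M] {f : X ≃ₜ X}
  {D : DirectProductStructure M} {p : M → X} {F : M ≃ₜ M}

namespace HyperbolicSplitting

theorem isPreconnected_plaque₂ [CompactSpace X] (h : HyperbolicSplitting f D p F) (x : M) :
    IsPreconnected (D.plaque₂ x) := by
  rw [← D.swap_plaque₁]
  exact h.swap.isPreconnected_plaque₁ x

theorem preconnectedSpace [CompactSpace X] (h : HyperbolicSplitting f D p F) :
    PreconnectedSpace M := by
  refine ⟨?_⟩
  rcases isEmpty_or_nonempty M with hM | hM
  · rw [eq_empty_of_isEmpty (univ : Set M)]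
    exact isPreconnected_empty
  · obtain ⟨x⟩ := hM
    have := ((h.isPreconnected_plaque₁ x).prod (h.isPreconnected_plaque₂ x)).image
      (fun q : M × M => D.br q.1 q.2) D.continuous_br.continuousOn
    rwa [show (fun q : M × M => D.br q.1 q.2) '' (D.plaque₁ x ×ˢ D.plaque₂ x) = univ from
      eq_univ_of_forall fun m => ⟨(D.br m x, D.br x m),
        ⟨D.br_mem_plaque₁ m x, D.br_br_right x x m⟩, D.br_proj m x⟩] at this

theorem exists_isPreconnected_mem_nhds (h : HyperbolicSplitting f D p F) {a : M} {W : Set M}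
    (hW : W ∈ 𝓝 a) : ∃ V ⊆ W, V ∈ 𝓝 a ∧ IsPreconnected V := by
  obtain ⟨C, -, hcharts⟩ := h.charts
  obtain ⟨O, hO, hsec⟩ := h.isCoveringMap.exists_sections (p a)
  obtain ⟨s, hs, hsa, hps, hev⟩ := hsec a (mem_of_mem_nhds hO)
  have hsW : s ⁻¹' W ∈ 𝓝 (p a) := by
    have := (hs.continuousAt hO)
    rw [ContinuousAt, hsa] at this
    exact this hW
  obtain ⟨R, hR, haR, hRO⟩ := hcharts (p a) _ (inter_mem hO hsW)
  refine ⟨s '' R.carrier, ?_, ?_, hR.isPreconnected.image s (hs.mono fun v hv => (hRO hv).1)⟩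
  · rintro _ ⟨v, hv, rfl⟩
    exact (hRO hv).2
  · filter_upwards [hev, h.isCoveringMap.continuous.continuousAt.preimage_mem_nhds
      (R.isOpen_carrier.mem_nhds haR)] with m hm hmR
    exact ⟨p m, hmR, hm⟩

/-- Any two points of the product lie in a compact connected set. -/
theorem exists_isCompact_isPreconnected [CompactSpace X] [ProperSpace M]
    (h : HyperbolicSplitting f D p F) (x y : M) :
    ∃ K : Set M, IsCompact K ∧ IsPreconnected K ∧ x ∈ K ∧ y ∈ K := by
  have := h.preconnectedSpace
  refine isPreconnected_univ.induction₂
    (fun x y => ∃ K : Set M, IsCompact K ∧ IsPreconnected K ∧ x ∈ K ∧ y ∈ K) ?_ ?_ ?_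
    (mem_univ x) (mem_univ y)
  · intro x _
    obtain ⟨V, hV, hVx, hVc⟩ := h.exists_isPreconnected_mem_nhds
      (Metric.closedBall_mem_nhds x one_pos)
    rw [nhdsWithin_univ]
    filter_upwards [hVx] with y hy
    exact ⟨closure V, (isCompact_closedBall x 1).of_isClosed_subset isClosed_closure
      (closure_minimal hV Metric.isClosed_closedBall), hVc.closure,
      subset_closure (mem_of_mem_nhds hVx), subset_closure hy⟩
  · rintro x y z - - - ⟨K, hK, hK', hx, hy⟩ ⟨L, hL, hL', hy', hz⟩
    exact ⟨K ∪ L, hK.union hL, hK'.union y hy hy' hL', Or.inl hx, Or.inr hz⟩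
  · rintro x y - - ⟨K, hK, hK', hx, hy⟩
    exact ⟨K, hK, hK', hy, hx⟩

/-- Over each point of the base one rectangle describes the bracket near all points of the fibre. -/
theorem eventually_map_br_eq (h : HyperbolicSplitting f D p F) (q : X) :
    ∃ R : Rectangle X, q ∈ R.carrier ∧ ∀ a, p a = q →
      ∀ᶠ z in 𝓝 (a, a), p (D.br z.1 z.2) = R.br (p z.1) (p z.2) := by
  obtain ⟨C, -, hcharts⟩ := h.charts
  obtain ⟨R, hR, hq, -⟩ := hcharts q univ univ_mem
  exact ⟨R, hq, fun a ha => hR.map_br a (ha ▸ hq)⟩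

/-- A continuous self-map of the product that respects the brackets and covers the identity on
the two plaques of `x` covers the identity everywhere. For a compact connected set `K` containing
`x`, the set of `y` such that the identity is covered on all `[y, z]`, `z ∈ K`, is clopen. -/
theorem map_comp_eq_of_plaques [CompactSpace X] [ProperSpace M]
    (h : HyperbolicSplitting f D p F) {g : M → M} (hg : Continuous g)
    (hbr : ∀ y z, g (D.br y z) = D.br (g y) (g z)) (x : M)
    (h₁ : ∀ y, p (g (D.br y x)) = p (D.br y x)) (h₂ : ∀ z, p (g (D.br x z)) = p (D.br x z))
    (m : M) : p (g m) = p m := by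
  obtain ⟨K, hK, hKc, hxK, hmK⟩ := h.exists_isCompact_isPreconnected x m
  have := h.preconnectedSpace
  have hp := h.isCoveringMap.continuous
  let T : M → M → Prop := fun y z => p (g (D.br y z)) = p (D.br y z)
  have hbrc := D.continuous_br
  have hTclosed : IsClosed {y | ∀ z ∈ K, T y z} := by
    simp only [T, Set.ofPred_forall]
    refine isClosed_biInter fun z _ => isClosed_eq ?_ ?_ <;> fun_prop
  have hTopen : IsOpen {y | ∀ z ∈ K, T y z} := by
    rw [isOpen_iff_mem_nhds]
    intro y₀ hy₀
    -- Near `[y₀, z₀]`, the identity is covered at `[y, z']` if it is at `[y, z]`.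
    have key₀ : ∀ z₀ ∈ K, ∀ᶠ r : (M × M) × M in 𝓝 ((y₀, z₀), z₀),
        r.2 ∈ K → T r.1.1 r.1.2 → T r.1.1 r.2 := by
      intro z₀ hz₀
      obtain ⟨R, -, hR⟩ := h.eventually_map_br_eq (p (D.br y₀ z₀))
      let Φ : (M × M) × M → M × M := fun r => (D.br r.1.1 r.1.2, D.br y₀ r.2)
      have hΦ : Continuous Φ := by fun_prop
      have hΦ' : Continuous fun r => (g (Φ r).1, g (Φ r).2) := by fun_prop
      filter_upwards [(hΦ.tendsto ((y₀, z₀), z₀)).eventually (hR _ rfl),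
        (hΦ'.tendsto ((y₀, z₀), z₀)).eventually (hR _ (hy₀ z₀ hz₀))] with r i₁ i₂ hrK hT
      simp only [Φ, ← hbr, D.br_br_br_br] at i₁ i₂
      change p (g (D.br r.1.1 r.2)) = p (D.br r.1.1 r.2)
      rw [i₁, i₂, show p (g (D.br r.1.1 r.1.2)) = p (D.br r.1.1 r.1.2) from hT, hy₀ r.2 hrK]
    have key : ∀ z₀ ∈ K, ∀ᶠ q : M × M in 𝓝 (y₀, z₀),
        q.2 ∈ K → ∀ᶠ z' in 𝓝[K] q.2, (T q.1 q.2 → T q.1 z') ∧ (T q.1 z' → T q.1 q.2) := by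
      intro z₀ hz₀
      have hσ : Continuous fun r : (M × M) × M => ((r.1.1, r.2), r.1.2) := by fun_prop
      have h' := (key₀ z₀ hz₀).and ((hσ.tendsto ((y₀, z₀), z₀)).eventually (key₀ z₀ hz₀))
      have hδ : Continuous fun q : M × M => (q, q.2) := by fun_prop
      filter_upwards [(hδ.tendsto (y₀, z₀)).eventually (eventually_eventually_nhds.2 h')]
        with q hq hqK
      have hι : Continuous fun z' : M => (q, z') := by fun_prop
      filter_upwards [mem_nhdsWithin_of_mem_nhds ((hι.tendsto q.2).eventually hq),
        self_mem_nhdsWithin] with z' hz' hz'K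
      exact ⟨hz'.1 hz'K, hz'.2 hqK⟩
    filter_upwards [hK.eventually_forall_of_forall_eventually (P := fun y z => z ∈ K →
      ∀ᶠ z' in 𝓝[K] z, (T y z → T y z') ∧ (T y z' → T y z)) key] with y hy z hz
    exact hKc.induction₂' (fun z z' => T y z → T y z') (fun z hz => hy z hz hz)
      (fun _ _ _ _ _ _ i j => j ∘ i) hxK hz (h₁ y)
  have huniv : {y | ∀ z ∈ K, T y z} = univ := by
    refine IsClopen.eq_univ ⟨hTclosed, hTopen⟩ ⟨x, fun z _ => h₂ z⟩
  have := (huniv ▸ mem_univ m : m ∈ {y | ∀ z ∈ K, T y z}) m hmK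
  simpa only [T, D.br_self] using this

/-- The deck transformations act transitively on the fibres of the covering. -/
theorem exists_deck_apply_eq [CompactSpace X] [ProperSpace M]
    (h : HyperbolicSplitting f D p F) {x x' : M} (hxx' : p x = p x') :
    ∃ g ∈ deckGroup D p, g x = x' := by
  obtain ⟨u, hu⟩ := h.holonomy₁ x x' hxx'
  obtain ⟨v, hv⟩ := h.holonomy₂ x x' hxx'
  have memP₂ : ∀ y m : M, D.br y m ∈ D.plaque₂ y := fun y m => by
    change D.br y (D.br y m) = D.br y m
    rw [D.br_br_right]
  have hbrc := D.continuous_br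
  -- The product of two homeomorphisms between plaques of `y` and of `y'`.
  let G : ∀ y y' : M, (D.plaque₁ y ≃ₜ D.plaque₁ y') → (D.plaque₂ y ≃ₜ D.plaque₂ y') → M → M :=
    fun y y' u v m =>
      D.br (u ⟨D.br m y, D.br_mem_plaque₁ m y⟩ : M) (v ⟨D.br y m, memP₂ y m⟩ : M)
  have hGc : ∀ y y' u v, Continuous (G y y' u v) := by
    intro y y' u v
    have i₁ : Continuous fun m => (u ⟨D.br m y, D.br_mem_plaque₁ m y⟩ : M) :=
      continuous_subtype_val.comp (u.continuous.comp (by fun_prop))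
    have i₂ : Continuous fun m => (v ⟨D.br y m, memP₂ y m⟩ : M) :=
      continuous_subtype_val.comp (v.continuous.comp (by fun_prop))
    exact hbrc.comp (i₁.prodMk i₂)
  have hG₁ : ∀ y y' u v m, D.br (G y y' u v m) y' = u ⟨D.br m y, D.br_mem_plaque₁ m y⟩ := by
    intro y y' u v m
    simp only [G, D.br_br_left]
    exact D.br_eq_left_iff.1 (u ⟨D.br m y, D.br_mem_plaque₁ m y⟩).2
  have hG₂ : ∀ y y' u v m, D.br y' (G y y' u v m) = v ⟨D.br y m, memP₂ y m⟩ := by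
    intro y y' u v m
    simp only [G, D.br_br_right]
    exact (v ⟨D.br y m, memP₂ y m⟩).2
  have hGinv : ∀ y y' u v m, G y' y u.symm v.symm (G y y' u v m) = m := by
    intro y y' u v m
    have : ∀ m', G y' y u.symm v.symm m' = D.br (u.symm ⟨D.br m' y', D.br_mem_plaque₁ m' y'⟩ : M)
      (v.symm ⟨D.br y' m', memP₂ y' m'⟩ : M) := fun _ => rfl
    rw [this]
    simp only [hG₁, hG₂, Subtype.coe_eta, Homeomorph.symm_apply_apply, D.br_proj]
  have hGbr : ∀ y z, G x x' u v (D.br y z) = D.br (G x x' u v y) (G x x' u v z) := by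
    intro y z
    simp only [G, D.br_br_br_br, D.br_br_left, D.br_br_right]
  have hux : ∀ a : D.plaque₁ x, (a : M) = x → (u a : M) = x' := by
    intro a ha
    exact h.injOn₁ x' _ _ (u a).2 (D.br_self x') ((hu a).trans (by rw [ha, hxx']))
  have hvx : ∀ a : D.plaque₂ x, (a : M) = x → (v a : M) = x' := by
    intro a ha
    exact h.injOn₂ x' _ _ (v a).2 (D.br_self x') ((hv a).trans (by rw [ha, hxx']))
  let g : M ≃ₜ M :=
    { toFun := G x x' u v
      invFun := G x' x u.symm v.symm
      left_inv := hGinv x x' u v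
      right_inv := fun m => by simpa using hGinv x' x u.symm v.symm m
      continuous_toFun := hGc _ _ _ _
      continuous_invFun := hGc _ _ _ _ }
  refine ⟨g, ⟨hGbr, h.map_comp_eq_of_plaques (hGc x x' u v) hGbr x ?_ ?_⟩, ?_⟩
  · intro y
    have : G x x' u v (D.br y x) = u ⟨D.br y x, D.br_mem_plaque₁ y x⟩ := by
      rw [hGbr, show G x x' u v x = x' from ?_, hG₁]
      change D.br _ _ = x'
      rw [hux _ (D.br_self x), hvx _ (D.br_self x), D.br_self]
    exact (congrArg p this).trans (hu _)
  · intro z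
    have : G x x' u v (D.br x z) = v ⟨D.br x z, memP₂ x z⟩ := by
      rw [hGbr, show G x x' u v x = x' from ?_, hG₂]
      change D.br _ _ = x'
      rw [hux _ (D.br_self x), hvx _ (D.br_self x), D.br_self]
    exact (congrArg p this).trans (hv _)
  · change D.br _ _ = x'
    rw [hux _ (D.br_self x), hvx _ (D.br_self x), D.br_self]

end HyperbolicSplitting

end

/-! ### Uniformity from cocompactness -/

section

variable {X M : Type*} [MetricSpace X] [MetricSpace M] {f : X ≃ₜ X}
  {D : DirectProductStructure M} {p : M → X} {F : M ≃ₜ M}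

/-- A property depending monotonically on a natural number that holds locally for some number
holds on a compact set for one number. -/
theorem IsCompact.exists_forall_of_monotone {Y : Type*} [TopologicalSpace Y] {K : Set Y}
    (hK : IsCompact K) {P : ℕ → Y → Prop} (hmono : ∀ m n y, m ≤ n → P m y → P n y)
    (hloc : ∀ y ∈ K, ∃ n, ∀ᶠ z in 𝓝 y, P n z) : ∃ n, ∀ y ∈ K, P n y := by
  refine hK.induction_on (p := fun S => ∃ n, ∀ y ∈ S, P n y) ⟨0, by simp⟩ ?_ ?_ ?_
  · rintro S T hST ⟨n, hn⟩
    exact ⟨n, fun y hy => hn y (hST hy)⟩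
  · rintro S T ⟨n, hn⟩ ⟨m, hm⟩
    refine ⟨max n m, ?_⟩
    rintro y (hy | hy)
    · exact hmono _ _ _ (le_max_left _ _) (hn y hy)
    · exact hmono _ _ _ (le_max_right _ _) (hm y hy)
  · intro y hy
    obtain ⟨n, hn⟩ := hloc y hy
    exact ⟨_, mem_nhdsWithin_of_mem_nhds hn, n, fun z hz => hz⟩

namespace HyperbolicSplitting

variable [CompactSpace X] [ProperSpace M]

/-- The group of deck transformations acts cocompactly. -/
theorem exists_cocompact (h : HyperbolicSplitting f D p F) (x : M) :
    ∃ r : ℝ, ∀ y : M, ∃ g ∈ deckGroup D p, dist (g x) y ≤ r := by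
  obtain ⟨n, hn⟩ := isCompact_univ.exists_forall_of_monotone (K := (univ : Set X))
    (P := fun n q => q ∈ p '' Metric.ball x n)
    (fun m n q hmn hq => image_mono (Metric.ball_subset_ball (by exact_mod_cast hmn)) hq) (by
      intro q _
      obtain ⟨a, rfl⟩ := h.surjective q
      obtain ⟨n, hn⟩ := exists_nat_gt (dist a x)
      exact ⟨n, (h.isCoveringMap.isOpenMap _ Metric.isOpen_ball).mem_nhds ⟨a, hn, rfl⟩⟩)
  refine ⟨n, fun y => ?_⟩
  obtain ⟨a, ha, hay⟩ := hn (p y) (mem_univ _)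
  obtain ⟨g, hg, hga⟩ := h.exists_deck_apply_eq hay
  refine ⟨g, hg, ?_⟩
  rw [← hga, h.dist_deck g hg, dist_comm]
  exact (Metric.mem_ball.1 ha).le

/-- A local, deck-invariant property of points holds uniformly. -/
theorem exists_forall (h : HyperbolicSplitting f D p F) {P : ℕ → M → Prop}
    (hmono : ∀ m n y, m ≤ n → P m y → P n y)
    (hdeck : ∀ g ∈ deckGroup D p, ∀ n y, P n (g y) → P n y)
    (hloc : ∀ y, ∃ n, ∀ᶠ z in 𝓝 y, P n z) : ∃ n, ∀ y, P n y := by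
  rcases isEmpty_or_nonempty M with hM | hM
  · exact ⟨0, fun y => hM.elim y⟩
  obtain ⟨x⟩ := hM
  obtain ⟨r, hr⟩ := h.exists_cocompact x
  obtain ⟨n, hn⟩ := (isCompact_closedBall x r).exists_forall_of_monotone hmono
    (fun y _ => hloc y)
  refine ⟨n, fun y => ?_⟩
  obtain ⟨g, hg, hgy⟩ := hr y
  refine hdeck _ (inv_mem hg) n y (hn _ ?_)
  rw [Metric.mem_closedBall, dist_comm, ← h.dist_deck g hg]
  change dist (g x) (g (g.symm y)) ≤ r
  rwa [g.apply_symm_apply]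

/-- A local, deck-invariant property of pairs of points holds uniformly at bounded distance. -/
theorem exists_forall_dist_le (h : HyperbolicSplitting f D p F) {P : ℕ → M → M → Prop}
    (hmono : ∀ m n y z, m ≤ n → P m y z → P n y z)
    (hdeck : ∀ g ∈ deckGroup D p, ∀ n y z, P n (g y) (g z) → P n y z)
    (hloc : ∀ y z, ∃ n, ∀ᶠ q : M × M in 𝓝 (y, z), P n q.1 q.2) (r : ℝ) :
    ∃ n, ∀ y z, dist y z ≤ r → P n y z := by
  refine h.exists_forall (P := fun n y => ∀ z, dist y z ≤ r → P n y z) ?_ ?_ ?_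
  · exact fun m n y hmn hy z hz => hmono m n y z hmn (hy z hz)
  · exact fun g hg n y hy z hz => hdeck g hg n y z (hy (g z) (by rwa [h.dist_deck g hg]))
  · intro y
    obtain ⟨n, hn⟩ := ((isCompact_closedBall y 1).prod
      (isCompact_closedBall y (r + 1))).exists_forall_of_monotone
      (P := fun n q => P n q.1 q.2) (fun m n q hmn => hmono m n q.1 q.2 hmn)
      (fun q _ => hloc q.1 q.2)
    refine ⟨n, ?_⟩
    filter_upwards [Metric.closedBall_mem_nhds y one_pos] with y' hy' z hz
    refine hn (y', z) ⟨hy', ?_⟩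
    have := Metric.mem_closedBall.1 hy'
    rw [Metric.mem_closedBall]
    linarith [dist_triangle_left z y y']

/-- A continuous deck-invariant function of two points is bounded at bounded distance. -/
theorem exists_bound_of_continuous (h : HyperbolicSplitting f D p F) {Φ : M × M → ℝ}
    (hΦ : Continuous Φ) (hdeck : ∀ g ∈ deckGroup D p, ∀ y z, Φ (g y, g z) = Φ (y, z)) (r : ℝ) :
    ∃ C : ℝ, 0 ≤ C ∧ ∀ y z, dist y z ≤ r → Φ (y, z) ≤ C := by
  obtain ⟨n, hn⟩ := h.exists_forall_dist_le (P := fun n y z => Φ (y, z) ≤ n)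
    (fun m n y z hmn hm => hm.trans (by exact_mod_cast hmn))
    (fun g hg n y z hm => by rwa [hdeck g hg] at hm) (fun y z => by
      obtain ⟨n, hn⟩ := exists_nat_gt (Φ (y, z))
      exact ⟨n, (hΦ.continuousAt.eventually (gt_mem_nhds hn)).mono fun q hq => hq.le⟩) r
  exact ⟨n, by positivity, hn⟩

/-- A lift of the dynamics is bornologous. -/
theorem exists_dist_lift_le (h : HyperbolicSplitting f D p F) (r : ℝ) :
    ∃ C : ℝ, 0 ≤ C ∧ ∀ y z, dist y z ≤ r → dist (F y) (F z) ≤ C := by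
  have hF := F.continuous
  refine h.exists_bound_of_continuous (Φ := fun q => dist (F q.1) (F q.2)) (by fun_prop) ?_ r
  intro g hg y z
  have := h.dist_deck _ (h.isLift.conj_mem hg) (F y) (F z)
  simpa only [Homeomorph.mul_apply, show ∀ m, F⁻¹ (F m) = m from F.symm_apply_apply] using this

theorem exists_dist_zpow_le (h : HyperbolicSplitting f D p F) (n : ℤ) (r : ℝ) :
    ∃ C : ℝ, 0 ≤ C ∧ ∀ y z, dist y z ≤ r → dist ((F ^ n) y) ((F ^ n) z) ≤ C := by
  have hF := (F ^ n).continuous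
  refine h.exists_bound_of_continuous (Φ := fun q => dist ((F ^ n) q.1) ((F ^ n) q.2))
    (by fun_prop) ?_ r
  intro g hg y z
  have := h.dist_deck _ ((h.isLift.zpow n).conj_mem hg) ((F ^ n) y) ((F ^ n) z)
  simpa only [Homeomorph.mul_apply,
    show ∀ m, (F ^ n)⁻¹ ((F ^ n) m) = m from (F ^ n).symm_apply_apply] using this

theorem exists_dist_br_le (h : HyperbolicSplitting f D p F) (r : ℝ) :
    ∃ C : ℝ, 0 ≤ C ∧ ∀ y z, dist y z ≤ r → dist (D.br y z) z ≤ C := by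
  have hbr := D.continuous_br
  refine h.exists_bound_of_continuous (Φ := fun q => dist (D.br q.1 q.2) q.2) (by fun_prop) ?_ r
  intro g hg y z
  simp only
  rw [← hg.1, h.dist_deck g hg]

/-- Any two invariant proper metrics are coarsely equivalent. -/
theorem exists_dist_le_of_dist_le {M : Type*} [m₀ : MetricSpace M] [ProperSpace M]
    {D : DirectProductStructure M} {p : M → X} {F : M ≃ₜ M} (h : HyperbolicSplitting f D p F)
    (m : MetricSpace M) (hm : @IsInvariantProperMetric X M _ m₀.toUniformSpace.toTopologicalSpace
      D p m) (r : ℝ) :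
    ∃ C : ℝ, 0 ≤ C ∧ ∀ y z, m₀.dist y z ≤ r → m.dist y z ≤ C := by
  have hc := @continuous_dist M m.toPseudoMetricSpace
  rw [@IsInvariantProperMetric.topology_eq X M _ m₀.toUniformSpace.toTopologicalSpace D p m hm]
    at hc
  exact @exists_bound_of_continuous X M _ m₀ f D p F _ _ h (fun q => m.dist q.1 q.2) hc
    (@IsInvariantProperMetric.invariant X M _ m₀.toUniformSpace.toTopologicalSpace D p m hm) r

/-! ### Dynamics on the plaques -/

/-- Two points of a plaque `P₁` are close if the forward orbits of their images are. -/
theorem exists_dist_le_of_forward_close (h : HyperbolicSplitting f D p F) {ε : ℝ} (hε : 0 < ε) :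
    ∃ δ > 0, ∀ a b, D.br a b = a → (∀ k : ℕ, dist ((f ^ k) (p a)) ((f ^ k) (p b)) ≤ δ) →
      dist a b ≤ ε := by
  obtain ⟨C, hC, hcharts⟩ := h.charts
  obtain ⟨δ, hδ, hkey⟩ := h.exists_section_eq hC
  suffices H : ∃ n : ℕ, ∀ a b, D.br a b = a →
      (∀ k : ℕ, dist ((f ^ k) (p a)) ((f ^ k) (p b)) ≤ 1 / ((n : ℝ) + 1)) → dist a b ≤ ε by
    obtain ⟨n, hn⟩ := H
    exact ⟨_, Nat.one_div_pos_of_nat, hn⟩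
  refine h.exists_forall ?_ ?_ ?_
  · exact fun m n a hmn hm b hab hk => hm b hab fun k => (hk k).trans
      (Nat.one_div_le_one_div hmn)
  · intro g hg n a hn b hab hk
    rw [← h.dist_deck g hg]
    refine hn (g b) (by rw [← hg.1, hab]) fun k => ?_
    rw [hg.2, hg.2]
    exact hk k
  · intro a₀
    obtain ⟨O, hO, hsec⟩ := h.isCoveringMap.exists_sections (p a₀)
    obtain ⟨s, hs, hsa, hps, hev⟩ := hsec a₀ (mem_of_mem_nhds hO)
    have hsO : s ⁻¹' Metric.ball a₀ (ε / 2) ∈ 𝓝 (p a₀) := by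
      have := hs.continuousAt hO
      rw [ContinuousAt, hsa] at this
      exact this (Metric.ball_mem_nhds _ (by positivity))
    obtain ⟨R, hR, haR, hRO⟩ := hcharts (p a₀) _ (inter_mem (inter_mem hO hsO)
      (Metric.ball_mem_nhds _ (half_pos hδ)))
    obtain ⟨η, hη, hηR⟩ := Metric.isOpen_iff.1 R.isOpen_carrier _ haR
    obtain ⟨n, hn⟩ := exists_nat_one_div_lt (lt_min hδ (half_pos hη))
    refine ⟨n, ?_⟩
    filter_upwards [hev, h.isCoveringMap.continuous.continuousAt.preimage_mem_nhds
      (Metric.ball_mem_nhds _ (half_pos hη))] with a hsa' hpa b hab hk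
    have h0 : dist (p a) (p b) ≤ 1 / ((n : ℝ) + 1) := hk 0
    have hpa' : dist (p a) (p a₀) < η / 2 := hpa
    have hbR : p b ∈ R.carrier := hηR (by
      rw [Metric.mem_ball]
      linarith [dist_triangle_left (p b) (p a₀) (p a), min_le_right δ (η / 2)])
    have haR : p a ∈ R.carrier := hηR (by rw [Metric.mem_ball]; linarith)
    have hsb := hkey R hR (fun u hu v hv => by
      have h1 := Metric.mem_ball.1 (hRO hu).2
      have h2 := Metric.mem_ball.1 (hRO hv).2
      linarith [dist_triangle_right u v (p a₀)]) a b hab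
      (fun k => (hk k).trans (hn.le.trans (min_le_left _ _))) haR hbR s
      (hs.mono fun v hv => (hRO hv).1.1) (fun v hv => hps v (hRO hv).1.1) hsa'
    have e1 : dist (s (p a)) a₀ < ε / 2 := (hRO haR).1.2
    have e2 : dist (s (p b)) a₀ < ε / 2 := (hRO hbR).1.2
    rw [hsa'] at e1
    rw [hsb] at e2
    linarith [dist_triangle_right a b a₀]

/-- The forward orbits of the images of two close points of a plaque `P₁` stay close. -/
theorem exists_forward_close_of_dist_le (h : HyperbolicSplitting f D p F) {η : ℝ} (hη : 0 < η) :
    ∃ δ > 0, ∀ a b, D.br a b = a → dist a b ≤ δ →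
      ∀ k : ℕ, dist ((f ^ k) (p a)) ((f ^ k) (p b)) ≤ η := by
  obtain ⟨C, hC, hcharts⟩ := h.charts
  suffices H : ∃ n : ℕ, ∀ a b, D.br a b = a → dist a b ≤ 1 / ((n : ℝ) + 1) →
      ∀ k : ℕ, dist ((f ^ k) (p a)) ((f ^ k) (p b)) ≤ η by
    obtain ⟨n, hn⟩ := H
    exact ⟨_, Nat.one_div_pos_of_nat, hn⟩
  refine h.exists_forall ?_ ?_ ?_
  · exact fun m n a hmn hm b hab hd => hm b hab (hd.trans (Nat.one_div_le_one_div hmn))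
  · intro g hg n a hn b hab hd k
    rw [← hg.2 a, ← hg.2 b]
    exact hn (g b) (by rw [← hg.1, hab]) (by rwa [h.dist_deck g hg]) k
  · intro a₀
    obtain ⟨R, hR, haR, hRO⟩ := hcharts (p a₀) _
      (Metric.ball_mem_nhds _ (show 0 < η / (2 * C) by positivity))
    have hp := h.isCoveringMap.continuous
    have e1 := hR.map_br a₀ haR
    have hp1 : Continuous fun q : M × M => p q.1 := by fun_prop
    have hp2 : Continuous fun q : M × M => p q.2 := by fun_prop
    have e2 : ∀ᶠ q : M × M in 𝓝 (a₀, a₀), p q.1 ∈ R.carrier :=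
      (hp1.tendsto (a₀, a₀)).eventually (R.isOpen_carrier.mem_nhds haR)
    have e3 : ∀ᶠ q : M × M in 𝓝 (a₀, a₀), p q.2 ∈ R.carrier :=
      (hp2.tendsto (a₀, a₀)).eventually (R.isOpen_carrier.mem_nhds haR)
    obtain ⟨ρ, hρ, hball⟩ := Metric.mem_nhds_iff.1 (e1.and (e2.and e3))
    obtain ⟨n, hn⟩ := exists_nat_one_div_lt (half_pos hρ)
    refine ⟨n, ?_⟩
    filter_upwards [Metric.ball_mem_nhds a₀ (half_pos hρ)] with a ha b hab hd k
    rw [Metric.mem_ball] at ha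
    obtain ⟨i1, i2, i3⟩ := hball (show (a, b) ∈ Metric.ball (a₀, a₀) ρ by
      rw [Metric.mem_ball, Prod.dist_eq, max_lt_iff]
      exact ⟨by simp only; linarith, by simp only; linarith [dist_triangle_left b a₀ a]⟩)
    simp only at i1 i2 i3
    rw [hab] at i1
    have h1 := hR.dist_le₁ _ i2 k (p a) ⟨i2, R.br_self _ i2⟩ (p b) ⟨i3, i1.symm⟩
    have h2 : dist (p a) (p b) ≤ η / C := by
      have j1 := Metric.mem_ball.1 (hRO i2)
      have j2 := Metric.mem_ball.1 (hRO i3)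
      have : η / C = η / (2 * C) + η / (2 * C) := by field_simp; ring
      linarith [dist_triangle_right (p a) (p b) (p a₀)]
    calc _ ≤ C * dist (p a) (p b) := h1
      _ ≤ C * (η / C) := by gcongr
      _ = η := by field_simp

/-- The iterates of `F` contract the plaques `P₁` uniformly on bounded scales: two points of a
plaque become close after some time, so do all pairs near them, and from then on the local
estimates apply. -/
theorem exists_contraction (h : HyperbolicSplitting f D p F) (r : ℝ) {ε : ℝ} (hε : 0 < ε) :
    ∃ N : ℕ, ∀ y z, D.br y z = y → dist y z ≤ r →
      ∀ n : ℕ, N ≤ n → dist ((F ^ (n : ℤ)) y) ((F ^ (n : ℤ)) z) ≤ ε := by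
  have hpF : ∀ (n : ℕ) m, p ((F ^ (n : ℤ)) m) = (f ^ n) (p m) := fun n m => by
    rw [h.map_zpow, zpow_natCast]
  have hadd : ∀ (k n : ℕ) q, (f ^ k) ((f ^ n) q) = (f ^ (k + n)) q := fun k n q => by
    rw [pow_add, Homeomorph.mul_apply]
  obtain ⟨η, hη, hclose⟩ := h.exists_dist_le_of_forward_close hε
  obtain ⟨δ, hδ, hfwd⟩ := h.exists_forward_close_of_dist_le hη
  obtain ⟨η', hη', hclose'⟩ := h.exists_dist_le_of_forward_close (half_pos hδ)
  obtain ⟨N, hN⟩ := h.exists_forall_dist_le (P := fun n y z => D.br y z = y →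
    ∀ k : ℕ, n ≤ k → dist ((f ^ k) (p y)) ((f ^ k) (p z)) ≤ η)
    (fun m n y z hmn hm hyz k hk => hm hyz k (hmn.trans hk))
    (fun g hg n y z hn hyz k hk => by
      have := hn (by rw [← hg.1, hyz]) k hk
      rwa [hg.2, hg.2] at this) (fun y₀ z₀ => by
      by_cases hyz₀ : D.br y₀ z₀ = y₀
      · obtain ⟨n, hn⟩ := eventually_atTop.1
          ((h.asymptotic₁ y₀ z₀ hyz₀).eventually (gt_mem_nhds hη'))
        have hd : dist ((F ^ (n : ℤ)) y₀) ((F ^ (n : ℤ)) z₀) ≤ δ / 2 := by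
          refine hclose' _ _ (h.br_zpow_eq n hyz₀) fun k => ?_
          rw [hpF, hpF, hadd, hadd]
          exact (hn _ (Nat.le_add_left _ _)).le
        have hF := (F ^ (n : ℤ)).continuous
        have hc : Continuous fun q : M × M => dist ((F ^ (n : ℤ)) q.1) ((F ^ (n : ℤ)) q.2) := by
          fun_prop
        refine ⟨n, ?_⟩
        filter_upwards [(hc.tendsto (y₀, z₀)).eventually
          (gt_mem_nhds (hd.trans_lt (half_lt_self hδ)))] with q hq hyz k hk
        have := hfwd _ _ (h.br_zpow_eq n hyz) hq.le (k - n)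
        rwa [hpF, hpF, hadd, hadd, Nat.sub_add_cancel hk] at this
      · refine ⟨0, ?_⟩
        have hbr := D.continuous_br
        filter_upwards [(isOpen_ne_fun (f := fun q : M × M => D.br q.1 q.2) (g := Prod.fst)
          (by fun_prop) (by fun_prop)).mem_nhds hyz₀] with q hq hq'
        exact absurd hq' hq) r
  refine ⟨N, fun y z hyz hd n hn => hclose _ _ (h.br_zpow_eq n hyz) fun k => ?_⟩
  rw [hpF, hpF, hadd, hadd]
  exact hN y z hd hyz _ (by omega)

end HyperbolicSplitting

end

/-! ### Expansivity and shadowing on the product -/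

section

variable {X M : Type*} [MetricSpace X] [MetricSpace M] {f : X ≃ₜ X}
  {D : DirectProductStructure M} {p : M → X} {F : M ≃ₜ M}

namespace HyperbolicSplitting

theorem zpow_apply_zpow_apply {M : Type*} [TopologicalSpace M] (F : M ≃ₜ M) (m n : ℤ) (x : M) :
    (F ^ m) ((F ^ n) x) = (F ^ (m + n)) x := by
  rw [zpow_add, Homeomorph.mul_apply]

theorem zpow_apply_eq_self {M : Type*} [TopologicalSpace M] {F : M ≃ₜ M} {x : M} (hx : F x = x)
    (n : ℤ) : (F ^ n) x = x := by
  have hpow : ∀ n : ℕ, (F ^ n) x = x := by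
    intro n
    induction n with
    | zero => rfl
    | succ n ih => rw [pow_succ, Homeomorph.mul_apply, hx, ih]
  obtain ⟨n, rfl | rfl⟩ := n.eq_nat_or_neg
  · rw [zpow_natCast, hpow]
  · rw [zpow_neg, zpow_natCast]
    exact (F ^ n).injective (((F ^ n).apply_symm_apply x).trans (hpow n).symm)

variable [CompactSpace X] [ProperSpace M]

/-- Distances on a plaque `P₁` are controlled by distances after many backward iterates. -/
theorem exists_dist_le_of_zpow_neg (h : HyperbolicSplitting f D p F) (r : ℝ) {ε : ℝ}
    (hε : 0 < ε) : ∃ N : ℕ, ∀ n : ℕ, N ≤ n → ∀ y z, D.br y z = y →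
      dist ((F ^ (-(n : ℤ))) y) ((F ^ (-(n : ℤ))) z) ≤ r → dist y z ≤ ε := by
  obtain ⟨N, hN⟩ := h.exists_contraction r hε
  refine ⟨N, fun n hn y z hyz hd => ?_⟩
  have := hN _ _ (h.br_zpow_eq _ hyz) hd n hn
  rwa [zpow_apply_zpow_apply, zpow_apply_zpow_apply, add_neg_cancel] at this

theorem exists_dist_le_of_zpow (h : HyperbolicSplitting f D p F) (r : ℝ) {ε : ℝ}
    (hε : 0 < ε) : ∃ N : ℕ, ∀ n : ℕ, N ≤ n → ∀ y z, D.br y z = z →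
      dist ((F ^ (n : ℤ)) y) ((F ^ (n : ℤ)) z) ≤ r → dist y z ≤ ε := by
  obtain ⟨N, hN⟩ := h.swap.exists_dist_le_of_zpow_neg r hε
  refine ⟨N, fun n hn y z hyz hd => hN n hn y z (D.br_eq_right_iff.1 hyz) ?_⟩
  simpa only [inv_zpow', neg_neg] using hd

/-- Points of a plaque `P₁` whose backward orbits stay at bounded distance along a sequence of
times are equal. -/
theorem eq_of_backward_bounded (h : HyperbolicSplitting f D p F) {y z : M} (hyz : D.br y z = y)
    {C : ℝ} (hC : ∀ N : ℕ, ∃ n : ℕ, N ≤ n ∧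
      dist ((F ^ (-(n : ℤ))) y) ((F ^ (-(n : ℤ))) z) ≤ C) : y = z := by
  refine dist_le_zero.1 (le_of_forall_pos_le_add fun ε hε => ?_)
  obtain ⟨N, hN⟩ := h.exists_dist_le_of_zpow_neg C hε
  obtain ⟨n, hn, hd⟩ := hC N
  rw [zero_add]
  exact hN n hn y z hyz hd

theorem eq_br_of_bounded (h : HyperbolicSplitting f D p F) {y z : M} {C : ℝ}
    (hC : ∀ n : ℤ, dist ((F ^ n) y) ((F ^ n) z) ≤ C) : z = D.br y z := by
  obtain ⟨C', -, hC'⟩ := h.exists_dist_br_le C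
  refine h.eq_of_backward_bounded (C := C') (D.br_mem_plaque₁ y z) fun N => ⟨N, le_rfl, ?_⟩
  rw [h.br_zpow, dist_comm]
  exact hC' _ _ (hC _)

/-- Orbits of the lift at bounded distance from each other are equal. -/
theorem eq_of_bounded (h : HyperbolicSplitting f D p F) {y z : M} {C : ℝ}
    (hC : ∀ n : ℤ, dist ((F ^ n) y) ((F ^ n) z) ≤ C) : y = z := by
  have h₂ : y = D.br y z := h.swap.eq_br_of_bounded (y := z) (z := y) (C := C) fun n => by
    rw [dist_comm, inv_zpow']
    exact hC _
  exact h₂.trans (h.eq_br_of_bounded hC).symm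

theorem exists_forward_bound (h : HyperbolicSplitting f D p F) {y z : M} (hyz : D.br y z = y) :
    ∃ C : ℝ, ∀ n : ℕ, dist ((F ^ (n : ℤ)) y) ((F ^ (n : ℤ)) z) ≤ C := by
  obtain ⟨N, hN⟩ := h.exists_contraction (dist y z) one_pos
  refine ⟨1 + ∑ i ∈ Finset.range N, dist ((F ^ (i : ℤ)) y) ((F ^ (i : ℤ)) z), fun n => ?_⟩
  have hnonneg : 0 ≤ ∑ i ∈ Finset.range N, dist ((F ^ (i : ℤ)) y) ((F ^ (i : ℤ)) z) :=
    Finset.sum_nonneg fun _ _ => dist_nonneg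
  rcases le_or_gt N n with hn | hn
  · linarith [hN y z hyz le_rfl n hn]
  · have := Finset.single_le_sum (f := fun i : ℕ => dist ((F ^ (i : ℤ)) y) ((F ^ (i : ℤ)) z))
      (fun _ _ => dist_nonneg) (Finset.mem_range.2 hn)
    linarith

theorem exists_backward_bound (h : HyperbolicSplitting f D p F) {y z : M} (hyz : D.br y z = z) :
    ∃ C : ℝ, ∀ n : ℕ, dist ((F ^ (-(n : ℤ))) y) ((F ^ (-(n : ℤ))) z) ≤ C := by
  simpa only [inv_zpow'] using h.swap.exists_forward_bound (D.br_eq_right_iff.1 hyz)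

theorem exists_pseudo_orbit_bound (h : HyperbolicSplitting f D p F) (c : ℝ) (m : ℕ) :
    ∃ C : ℝ, ∀ z : ℤ → M, (∀ n, dist (F (z n)) (z (n + 1)) ≤ c) →
      ∀ n, dist ((F ^ (m : ℤ)) (z n)) (z (n + m)) ≤ C := by
  induction m with
  | zero =>
    exact ⟨0, fun z _ n => by
      rw [Nat.cast_zero, zpow_zero, add_zero, Homeomorph.one_apply, dist_self]⟩
  | succ m ih =>
    obtain ⟨C, hC⟩ := ih
    obtain ⟨C', -, hC'⟩ := h.exists_dist_lift_le C
    refine ⟨C' + c, fun z hz n => ?_⟩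
    have h1 := hC' _ _ (hC z hz n)
    have h2 := hz (n + m)
    have h3 : (F ^ ((m + 1 : ℕ) : ℤ)) (z n) = F ((F ^ (m : ℤ)) (z n)) := by
      rw [Nat.cast_succ, add_comm, zpow_one_add, Homeomorph.mul_apply]
    rw [h3, Nat.cast_succ, ← add_assoc]
    exact (dist_triangle _ _ _).trans (add_le_add h1 h2)

/-- The finite part of the shadowing property of the plaques `P₁`. The relation `E n y z`, saying
that the iterates `Fᵏ` of `y` and `z` are at distance at most `1` for all `k ≥ -n`, behaves like
the balls of an ultrametric: `E (n + q)` composed with itself lies in `E n`. The lift maps `E n` to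
`E (n + 1)`, so the errors of a pseudo-orbit of `F ^ q` do not accumulate. -/
theorem exists_dist_zpow_pseudo_orbit_le (h : HyperbolicSplitting f D p F) (c : ℝ) :
    ∃ q : ℕ, 0 < q ∧ ∃ C : ℝ, ∀ z : ℤ → M, (∀ m n, D.br (z m) ((F ^ n) (z (m - n))) = z m) →
      (∀ n, dist (F (z n)) (z (n + 1)) ≤ c) →
        ∀ (j : ℕ) (n : ℤ), dist ((F ^ ((j * q : ℕ) : ℤ)) (z (n - (j * q : ℕ)))) (z n) ≤ C := by
  obtain ⟨N₂, hN₂⟩ := h.exists_contraction 2 one_pos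
  obtain ⟨q, hq, hqN₂⟩ : ∃ q : ℕ, 0 < q ∧ N₂ ≤ q := ⟨N₂ + 1, by omega, by omega⟩
  obtain ⟨c', hc'⟩ := h.exists_pseudo_orbit_bound c q
  obtain ⟨N, hN⟩ := h.exists_contraction c' one_pos
  obtain ⟨C, -, hC⟩ := h.exists_dist_zpow_le (-((N + q : ℕ) : ℤ)) 1
  let E : ℤ → M → M → Prop := fun n y z => ∀ k : ℤ, -n ≤ k → dist ((F ^ k) y) ((F ^ k) z) ≤ 1
  have Etrans : ∀ n x y z, D.br x z = x → E (n + q) x y → E (n + q) y z → E n x z := by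
    intro n x y z hxz hxy hyz k hk
    have h1 := hxy (k - q) (by omega)
    have h2 := hyz (k - q) (by omega)
    have h3 := hN₂ _ _ (h.br_zpow_eq (k - q) hxz) (by
      linarith [dist_triangle ((F ^ (k - (q : ℤ))) x) ((F ^ (k - (q : ℤ))) y)
        ((F ^ (k - (q : ℤ))) z)]) q hqN₂
    rwa [zpow_apply_zpow_apply, zpow_apply_zpow_apply, add_sub_cancel] at h3
  have Eshift : ∀ n m y z, E n y z → E (n + m) ((F ^ m) y) ((F ^ m) z) := by
    intro n m y z hyz k hk
    rw [zpow_apply_zpow_apply, zpow_apply_zpow_apply]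
    exact hyz _ (by omega)
  refine ⟨q, hq, C, fun z hz hjump j n => ?_⟩
  have hE : ∀ (j : ℕ) (n : ℤ),
      E (-((N + q : ℕ) : ℤ)) ((F ^ ((j * q : ℕ) : ℤ)) (z (n - (j * q : ℕ)))) (z n) := by
    intro j
    induction j with
    | zero =>
      intro n k _
      simp
    | succ j ih =>
      intro n
      have h1 := Eshift _ q _ _ (ih (n - q))
      have h2 : E (-(N : ℤ)) ((F ^ (q : ℤ)) (z (n - q))) (z n) := by
        intro k hk
        have h3 := hc' z hjump (n - q)
        rw [sub_add_cancel] at h3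
        have h4 := hN _ _ (D.br_eq_left_iff.1 (hz n q)) h3 k.toNat (by omega)
        rwa [Int.toNat_of_nonneg (by omega)] at h4
      rw [zpow_apply_zpow_apply] at h1
      have e1 : (q : ℤ) + ((j * q : ℕ) : ℤ) = (((j + 1) * q : ℕ) : ℤ) := by push_cast; ring
      have e2 : n - (q : ℤ) - ((j * q : ℕ) : ℤ) = n - (((j + 1) * q : ℕ) : ℤ) := by
        push_cast; ring
      rw [e1, e2] at h1
      refine Etrans _ _ ((F ^ (q : ℤ)) (z (n - q))) _ ?_ ?_ ?_
      · exact D.br_eq_left_iff.1 (hz n _)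
      · convert h1 using 1
      · convert h2 using 1
        push_cast; ring
  have h1 := hC _ _ (hE j n ((N + q : ℕ) : ℤ) (by omega))
  simpa only [zpow_apply_zpow_apply, neg_add_cancel, zpow_zero,
    Homeomorph.one_apply, neg_add_cancel_left] using h1

/-- Pseudo-orbits contained in the plaque `P₁` of a fixed point are shadowed by orbits. -/
theorem exists_shadow₁ (h : HyperbolicSplitting f D p F) {x : M} (hx : F x = x) (c : ℝ) :
    ∃ C : ℝ, ∀ z : ℤ → M, (∀ n, z n ∈ D.plaque₁ x) → (∀ n, dist (F (z n)) (z (n + 1)) ≤ c) →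
      ∃ w ∈ D.plaque₁ x, ∀ n, dist ((F ^ n) w) (z n) ≤ C := by
  obtain ⟨q, hq, C, hC⟩ := h.exists_dist_zpow_pseudo_orbit_le c
  obtain ⟨C', -, hC'⟩ := h.exists_dist_lift_le C
  have hinv : ∀ (n : ℤ) {y : M}, D.br x y = x → D.br x ((F ^ n) y) = x := by
    intro n y hy
    have := h.br_zpow_eq n hy
    rwa [zpow_apply_eq_self hx] at this
  have hsame : ∀ {y z : M}, D.br x y = x → D.br x z = x → D.br y z = y := fun hy hz =>
    D.br_left_trans (D.br_eq_left_iff.1 hy) hz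
  have hbr := D.continuous_br
  -- A limit point of `F ^ (k q)` applied to `z (-k q)` shadows the sequence at the times `-j q`.
  have key : ∀ z : ℤ → M, (∀ n, z n ∈ D.plaque₁ x) → (∀ n, dist (F (z n)) (z (n + 1)) ≤ c) →
      ∃ w ∈ D.plaque₁ x, ∀ j : ℕ,
        dist ((F ^ (-((j * q : ℕ) : ℤ))) w) (z (-((j * q : ℕ) : ℤ))) ≤ C := by
    intro z hz hjump
    have hb := hC z (fun m n => hsame (hz m) (hinv _ (hz _))) hjump
    let w : ℕ → M := fun k => (F ^ ((k * q : ℕ) : ℤ)) (z (-((k * q : ℕ) : ℤ)))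
    have hw : ∀ k, w k ∈ Metric.closedBall (z 0) C := fun k => by
      have := hb k 0
      rwa [zero_sub] at this
    obtain ⟨w₀, -, φ, hφ, hlim⟩ := (isCompact_closedBall (z 0) C).tendsto_subseq hw
    refine ⟨w₀, ?_, fun j => ?_⟩
    · have hcl : IsClosed {y | D.br x y = x} := isClosed_eq (by fun_prop) continuous_const
      exact hcl.mem_of_tendsto hlim (Eventually.of_forall fun k => hinv _ (hz _))
    · have hF := (F ^ (-((j * q : ℕ) : ℤ))).continuous
      have hlim' := ((hF.tendsto w₀).comp hlim).dist
        (tendsto_const_nhds (x := z (-((j * q : ℕ) : ℤ))))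
      refine le_of_tendsto hlim' ?_
      filter_upwards [hφ.tendsto_atTop.eventually_ge_atTop j] with k hk
      have := hb (φ k - j) (-((j * q : ℕ) : ℤ))
      simp only [Function.comp, w, zpow_apply_zpow_apply]
      have e : (((φ k - j) * q : ℕ) : ℤ) = -((j * q : ℕ) : ℤ) + ((φ k * q : ℕ) : ℤ) := by
        rw [Nat.sub_mul, Nat.cast_sub (Nat.mul_le_mul_right q hk)]
        ring
      rwa [e, sub_add_cancel_left] at this
  refine ⟨C, fun z hz hjump => ?_⟩
  have hkey := fun n : ℤ => key (fun m => z (n + m)) (fun m => hz _) fun m => by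
    rw [← add_assoc]
    exact hjump _
  choose w hw hwz using hkey
  have hstep : ∀ n, F (w n) = w (n + 1) := by
    intro n
    have hFw : D.br x (F (w n)) = x := by
      have := hinv 1 (hw n)
      rwa [zpow_one] at this
    refine h.eq_of_backward_bounded (C := C' + c + C) (hsame hFw (hw (n + 1))) fun N =>
      ⟨N * q, Nat.le_mul_of_pos_right N hq, ?_⟩
    have h1 := hC' _ _ (hwz n N)
    have h2 := hjump (n + -((N * q : ℕ) : ℤ))
    have h3 := hwz (n + 1) N
    have e1 : (F ^ (-((N * q : ℕ) : ℤ))) (F (w n)) = F ((F ^ (-((N * q : ℕ) : ℤ))) (w n)) := by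
      rw [← Homeomorph.mul_apply, ← Homeomorph.mul_apply, ← zpow_add_one, ← zpow_one_add, add_comm]
    have e2 : n + 1 + -((N * q : ℕ) : ℤ) = n + -((N * q : ℕ) : ℤ) + 1 := by ring
    rw [e2, dist_comm] at h3
    rw [e1]
    refine (dist_triangle _ _ _).trans (add_le_add ((dist_triangle _ _ _).trans
      (add_le_add h1 h2)) h3)
  have hpow : ∀ n : ℤ, (F ^ n) (w 0) = w n := by
    intro n
    induction n with
    | zero => rfl
    | succ n ih => rw [add_comm, zpow_one_add, Homeomorph.mul_apply, ih, hstep, add_comm]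
    | pred n ih =>
      refine F.injective ?_
      rw [hstep, sub_add_cancel, ← ih, ← Homeomorph.mul_apply, ← zpow_one_add, add_sub_cancel]
  refine ⟨w 0, hw 0, fun n => ?_⟩
  rw [hpow]
  simpa using hwz n 0

theorem exists_shadow₂ (h : HyperbolicSplitting f D p F) {x : M} (hx : F x = x) (c : ℝ) :
    ∃ C : ℝ, ∀ z : ℤ → M, (∀ n, z n ∈ D.plaque₂ x) → (∀ n, dist (F (z n)) (z (n + 1)) ≤ c) →
      ∃ w ∈ D.plaque₂ x, ∀ n, dist ((F ^ n) w) (z n) ≤ C := by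
  obtain ⟨c', -, hc'⟩ := h.swap.exists_dist_lift_le c
  have hx' : F⁻¹ x = x := F.injective ((F.apply_symm_apply x).trans hx.symm)
  obtain ⟨C, hC⟩ := h.swap.exists_shadow₁ hx' c'
  rw [D.swap_plaque₁] at hC
  refine ⟨C, fun z hz hjump => ?_⟩
  obtain ⟨w, hw, hwz⟩ := hC (fun n => z (-n)) (fun n => hz _) fun n => by
    have h1 := hc' _ _ (hjump (-(n + 1)))
    rw [show F⁻¹ (F (z (-(n + 1)))) = z (-(n + 1)) from F.symm_apply_apply _,
      show -(n + 1) + 1 = -n by ring] at h1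
    rwa [dist_comm]
  refine ⟨w, hw, fun n => ?_⟩
  have := hwz (-n)
  rwa [inv_zpow', neg_neg] at this

/-- Only finitely many deck transformations move a point by at most a given distance. -/
theorem finite_deck_dist_le (h : HyperbolicSplitting f D p F) (x : M) (r : ℝ) :
    {g : deckGroup D p | dist x ((g : M ≃ₜ M) x) ≤ r}.Finite := by
  have := h.preconnectedSpace
  have hdisc := (h.isCoveringMap (p x)).discreteTopology_fiber
  have hfin : (Metric.closedBall x r ∩ p ⁻¹' {p x}).Finite := by
    refine IsCompact.finite ((isCompact_closedBall x r).inter_right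
      (isClosed_singleton.preimage h.isCoveringMap.continuous)) ?_
    exact (isDiscrete_iff_discreteTopology.2 hdisc).mono inter_subset_right
  refine hfin.of_injOn (f := fun g : deckGroup D p => (g : M ≃ₜ M) x) ?_ ?_
  · intro g hg
    exact ⟨by rw [Metric.mem_closedBall, dist_comm]; exact hg, g.2.2 x⟩
  · intro g _ g' _ hgg'
    have := h.isCoveringMap.eq_of_comp_eq (g : M ≃ₜ M).continuous (g' : M ≃ₜ M).continuous
      (funext fun y => (g.2.2 y).trans (g'.2.2 y).symm) x hgg'
    exact Subtype.ext (Homeomorph.ext fun y => congrFun this y)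

end HyperbolicSplitting

end

/-! ### Isomorphisms of deck groups and the induced equivariant homeomorphism -/

section

variable {X₁ X₂ M₁ M₂ : Type*} [MetricSpace X₁] [MetricSpace M₁] [MetricSpace X₂] [MetricSpace M₂]
  {f₁ : X₁ ≃ₜ X₁} {D₁ : DirectProductStructure M₁} {p₁ : M₁ → X₁} {F₁ : M₁ ≃ₜ M₁}
  {f₂ : X₂ ≃ₜ X₂} {D₂ : DirectProductStructure M₂} {p₂ : M₂ → X₂} {F₂ : M₂ ≃ₜ M₂}

section Corresponds

variable {X₁ X₂ M₁ M₂ : Type*} [MetricSpace M₁] [MetricSpace M₂]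
  {D₁ : DirectProductStructure M₁} {p₁ : M₁ → X₁} {F₁ : M₁ ≃ₜ M₁}
  {D₂ : DirectProductStructure M₂} {p₂ : M₂ → X₂} {F₂ : M₂ ≃ₜ M₂}

/-- The points `m` and `m'` correspond to each other with the error `C`: one sequence `g` of deck
transformations follows the orbit of `m`, while its image under `ψ` follows the orbit of `m'`. -/
def Corresponds (ψ : deckGroup D₁ p₁ ≃* deckGroup D₂ p₂) (F₁ : M₁ ≃ₜ M₁) (F₂ : M₂ ≃ₜ M₂)
    (x₁ : M₁) (x₂ : M₂) (C : ℝ) (m : M₁) (m' : M₂) : Prop :=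
  ∃ g : ℤ → deckGroup D₁ p₁, ∀ n, dist ((g n : M₁ ≃ₜ M₁) x₁) ((F₁ ^ n) m) ≤ C ∧
    dist ((ψ (g n) : M₂ ≃ₜ M₂) x₂) ((F₂ ^ n) m') ≤ C

theorem Corresponds.symm {ψ : deckGroup D₁ p₁ ≃* deckGroup D₂ p₂} {x₁ : M₁} {x₂ : M₂} {C : ℝ}
    {m : M₁} {m' : M₂} (h : Corresponds ψ F₁ F₂ x₁ x₂ C m m') :
    Corresponds ψ.symm F₂ F₁ x₂ x₁ C m' m := by
  obtain ⟨g, hg⟩ := h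
  refine ⟨fun n => ψ (g n), fun n => ⟨(hg n).2, ?_⟩⟩
  rw [ψ.symm_apply_apply]
  exact (hg n).1

theorem Corresponds.lift {ψ : deckGroup D₁ p₁ ≃* deckGroup D₂ p₂} {x₁ : M₁} {x₂ : M₂} {C : ℝ}
    {m : M₁} {m' : M₂}
    (h : Corresponds ψ F₁ F₂ x₁ x₂ C m m') :
    Corresponds ψ F₁ F₂ x₁ x₂ C (F₁ m) (F₂ m') := by
  obtain ⟨g, hg⟩ := h
  refine ⟨fun n => g (n + 1), fun n => ?_⟩
  have := hg (n + 1)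
  rwa [zpow_add_one, zpow_add_one, Homeomorph.mul_apply, Homeomorph.mul_apply] at this

end Corresponds

namespace HyperbolicSplitting

variable [CompactSpace X₁] [ProperSpace M₁]

/-- An isomorphism between the groups of deck transformations is bornologous on orbits. -/
theorem exists_dist_deck_le (h₁ : HyperbolicSplitting f₁ D₁ p₁ F₁)
    (h₂ : HyperbolicSplitting f₂ D₂ p₂ F₂) (x₁ : M₁) (x₂ : M₂)
    (ψ : deckGroup D₁ p₁ ≃* deckGroup D₂ p₂) (r : ℝ) :
    ∃ C : ℝ, ∀ g g' : deckGroup D₁ p₁,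
      dist ((g : M₁ ≃ₜ M₁) x₁) ((g' : M₁ ≃ₜ M₁) x₁) ≤ r →
        dist ((ψ g : M₂ ≃ₜ M₂) x₂) ((ψ g' : M₂ ≃ₜ M₂) x₂) ≤ C := by
  obtain ⟨C, hC⟩ := ((h₁.finite_deck_dist_le x₁ r).image
    fun g => dist x₂ ((ψ g : M₂ ≃ₜ M₂) x₂)).bddAbove
  refine ⟨C, fun g g' hgg' => ?_⟩
  have h : dist x₁ (((g⁻¹ * g' : deckGroup D₁ p₁) : M₁ ≃ₜ M₁) x₁) ≤ r := by
    rw [← h₁.dist_deck _ g.2, ← Homeomorph.mul_apply, ← Subgroup.coe_mul, mul_inv_cancel_left]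
    exact hgg'
  have := hC ⟨g⁻¹ * g', h, rfl⟩
  simp only [map_mul, map_inv] at this
  rw [← h₂.dist_deck _ (ψ g).2, ← Homeomorph.mul_apply, ← Subgroup.coe_mul,
    mul_inv_cancel_left] at this
  exact this

variable {x₁ : M₁} {x₂ : M₂} {ψ : deckGroup D₁ p₁ ≃* deckGroup D₂ p₂}

/-- The correspondence with a uniform error is continuous on a set `A₁` if it takes values in a
set `A₂` on which distances are controlled by distances after some iterate of the lift. -/
theorem continuousOn_of_corresponds (h₁ : HyperbolicSplitting f₁ D₁ p₁ F₁)
    (h₂ : HyperbolicSplitting f₂ D₂ p₂ F₂) {A₁ : Set M₁}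
    {A₂ : Set M₂} (hcontract : ∀ r ε : ℝ, 0 < ε → ∃ k : ℤ, ∀ y ∈ A₂, ∀ z ∈ A₂,
      dist ((F₂ ^ k) y) ((F₂ ^ k) z) ≤ r → dist y z ≤ ε) {T : M₁ → M₂} {C : ℝ}
    (hT : ∀ y ∈ A₁, T y ∈ A₂ ∧ Corresponds ψ F₁ F₂ x₁ x₂ C y (T y)) : ContinuousOn T A₁ := by
  obtain ⟨K, hK⟩ := h₁.exists_dist_deck_le h₂ x₁ x₂ ψ (C + 1 + C)
  intro y hy
  rw [ContinuousWithinAt, Metric.tendsto_nhds]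
  intro ε hε
  obtain ⟨k, hk⟩ := hcontract (C + K + C) (ε / 2) (half_pos hε)
  have hF : Continuous fun z => dist ((F₁ ^ k) z) ((F₁ ^ k) y) :=
    ((F₁ ^ k).continuous).dist continuous_const
  have hev : ∀ᶠ z in 𝓝 y, dist ((F₁ ^ k) z) ((F₁ ^ k) y) < 1 :=
    (hF.tendsto y).eventually (gt_mem_nhds (by simp))
  filter_upwards [mem_nhdsWithin_of_mem_nhds hev, self_mem_nhdsWithin] with z hzy hz
  obtain ⟨hTz, g, hg⟩ := hT z hz
  obtain ⟨hTy, g', hg'⟩ := hT y hy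
  refine (hk _ hTz _ hTy ?_).trans_lt (half_lt_self hε)
  have j := (hg' k).1
  rw [dist_comm] at j
  have i₁ := hK (g k) (g' k) ((dist_triangle4 _ _ _ _).trans
    (add_le_add (add_le_add (hg k).1 hzy.le) j))
  have i₂ := (hg k).2
  rw [dist_comm] at i₂
  exact (dist_triangle4 _ _ _ _).trans (add_le_add (add_le_add i₂ i₁) (hg' k).2)

variable [CompactSpace X₂] [ProperSpace M₂]

/-- A point corresponds to at most one point, since orbits of `F₂` at bounded distance are equal. -/
theorem corresponds_unique (h₁ : HyperbolicSplitting f₁ D₁ p₁ F₁)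
    (h₂ : HyperbolicSplitting f₂ D₂ p₂ F₂) {C C' : ℝ} {m : M₁}
    {m' m'' : M₂} (h : Corresponds ψ F₁ F₂ x₁ x₂ C m m')
    (h' : Corresponds ψ F₁ F₂ x₁ x₂ C' m m'') : m' = m'' := by
  obtain ⟨g, hg⟩ := h
  obtain ⟨g', hg'⟩ := h'
  obtain ⟨K, hK⟩ := h₁.exists_dist_deck_le h₂ x₁ x₂ ψ (C + C')
  refine h₂.eq_of_bounded (C := C + K + C') fun n => ?_
  have i₁ := hK (g n) (g' n) ((dist_triangle_right _ _ ((F₁ ^ n) m)).trans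
    (add_le_add (hg n).1 (hg' n).1))
  have i₂ := (hg n).2
  rw [dist_comm] at i₂
  exact (dist_triangle4 _ _ _ _).trans (add_le_add (add_le_add i₂ i₁) (hg' n).2)

/-- If `y` and `z` correspond to `y'` and `z'`, then `[y, z]` corresponds to `[y', z']`: in forward
time the brackets stay at bounded distance from the orbits of `z` and `z'`, in backward time from
the orbits of `y` and `y'`. -/
theorem corresponds_br (h₁ : HyperbolicSplitting f₁ D₁ p₁ F₁)
    (h₂ : HyperbolicSplitting f₂ D₂ p₂ F₂) {C C' : ℝ} {y z : M₁}
    {y' z' : M₂} (hy : Corresponds ψ F₁ F₂ x₁ x₂ C y y')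
    (hz : Corresponds ψ F₁ F₂ x₁ x₂ C' z z') :
    ∃ K, Corresponds ψ F₁ F₂ x₁ x₂ K (D₁.br y z) (D₂.br y' z') := by
  obtain ⟨g, hg⟩ := hy
  obtain ⟨g', hg'⟩ := hz
  obtain ⟨a, ha⟩ := h₁.exists_forward_bound (D₁.br_mem_plaque₁ y z)
  obtain ⟨a', ha'⟩ := h₂.exists_forward_bound (D₂.br_mem_plaque₁ y' z')
  obtain ⟨b, hb⟩ := h₁.exists_backward_bound (D₁.br_br_right y y z)
  obtain ⟨b', hb'⟩ := h₂.exists_backward_bound (D₂.br_br_right y' y' z')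
  refine ⟨max (max (C' + a) (C' + a')) (max (C + b) (C + b')),
    fun n => if 0 ≤ n then g' n else g n, fun n => ?_⟩
  beta_reduce
  split_ifs with hn
  · lift n to ℕ using hn
    have i := (dist_triangle _ _ _).trans (add_le_add (hg' n).1 (ha n))
    have i' := (dist_triangle _ _ _).trans (add_le_add (hg' n).2 (ha' n))
    exact ⟨i.trans ((le_max_left _ _).trans (le_max_left _ _)),
      i'.trans ((le_max_right _ _).trans (le_max_left _ _))⟩
  · obtain ⟨k, rfl⟩ : ∃ k : ℕ, n = -(k : ℤ) := ⟨n.natAbs, by omega⟩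
    have i := (dist_triangle _ _ _).trans (add_le_add (hg (-(k : ℤ))).1 (hb k))
    have i' := (dist_triangle _ _ _).trans (add_le_add (hg (-(k : ℤ))).2 (hb' k))
    exact ⟨i.trans ((le_max_left _ _).trans (le_max_right _ _)),
      i'.trans ((le_max_right _ _).trans (le_max_right _ _))⟩

end HyperbolicSplitting

/-- An isomorphism `ψ` of the groups of deck transformations of two splittings that is compatible
with the lifts and coarsely preserves the plaques of the fixed points `x₁` and `x₂`: elements of
the first group moving `x₁` near its plaque correspond to elements of the second group moving `x₂`
near its plaque, and each of the four plaques is reached by such elements up to a bounded error. -/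
structure SplittingIsomorphism (h₁ : HyperbolicSplitting f₁ D₁ p₁ F₁)
    (h₂ : HyperbolicSplitting f₂ D₂ p₂ F₂) (x₁ : M₁) (x₂ : M₂)
    (ψ : deckGroup D₁ p₁ ≃* deckGroup D₂ p₂) : Prop where
  fixed₁ : F₁ x₁ = x₁
  fixed₂ : F₂ x₂ = x₂
  map_inducedAut : ∀ g, ψ (inducedAut h₁.isLift g) = inducedAut h₂.isLift (ψ g)
  plaque₁ : ∃ r : ℝ, ∀ y ∈ D₁.plaque₁ x₁, ∃ g : deckGroup D₁ p₁,
    dist ((g : M₁ ≃ₜ M₁) x₁) y ≤ r ∧ ∃ z ∈ D₂.plaque₁ x₂, dist ((ψ g : M₂ ≃ₜ M₂) x₂) z ≤ r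
  plaque₂ : ∃ r : ℝ, ∀ y ∈ D₁.plaque₂ x₁, ∃ g : deckGroup D₁ p₁,
    dist ((g : M₁ ≃ₜ M₁) x₁) y ≤ r ∧ ∃ z ∈ D₂.plaque₂ x₂, dist ((ψ g : M₂ ≃ₜ M₂) x₂) z ≤ r
  symm_plaque₁ : ∃ r : ℝ, ∀ z ∈ D₂.plaque₁ x₂, ∃ g : deckGroup D₂ p₂,
    dist ((g : M₂ ≃ₜ M₂) x₂) z ≤ r ∧
      ∃ y ∈ D₁.plaque₁ x₁, dist ((ψ.symm g : M₁ ≃ₜ M₁) x₁) y ≤ r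
  symm_plaque₂ : ∃ r : ℝ, ∀ z ∈ D₂.plaque₂ x₂, ∃ g : deckGroup D₂ p₂,
    dist ((g : M₂ ≃ₜ M₂) x₂) z ≤ r ∧
      ∃ y ∈ D₁.plaque₂ x₁, dist ((ψ.symm g : M₁ ≃ₜ M₁) x₁) y ≤ r

theorem inducedAut_apply_apply {f₁ : X₁ ≃ₜ X₁} (hF : IsLift f₁ D₁ p₁ F₁) (g : deckGroup D₁ p₁)
    (m : M₁) : (inducedAut hF g : M₁ ≃ₜ M₁) (F₁ m) = F₁ ((g : M₁ ≃ₜ M₁) m) := by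
  change F₁ ((g : M₁ ≃ₜ M₁) (F₁⁻¹ (F₁ m))) = _
  rw [show F₁⁻¹ (F₁ m) = m from F₁.symm_apply_apply m]

namespace SplittingIsomorphism

variable {h₁ : HyperbolicSplitting f₁ D₁ p₁ F₁} {h₂ : HyperbolicSplitting f₂ D₂ p₂ F₂}
  {x₁ : M₁} {x₂ : M₂} {ψ : deckGroup D₁ p₁ ≃* deckGroup D₂ p₂}

theorem symm (H : SplittingIsomorphism h₁ h₂ x₁ x₂ ψ) :
    SplittingIsomorphism h₂ h₁ x₂ x₁ ψ.symm where
  fixed₁ := H.fixed₂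
  fixed₂ := H.fixed₁
  map_inducedAut g := ψ.injective (by
    rw [ψ.apply_symm_apply, H.map_inducedAut, ψ.apply_symm_apply])
  plaque₁ := H.symm_plaque₁
  plaque₂ := H.symm_plaque₂
  symm_plaque₁ := H.plaque₁
  symm_plaque₂ := H.plaque₂

/-- Corresponding points have corresponding images under deck transformations. -/
theorem corresponds_deck (H : SplittingIsomorphism h₁ h₂ x₁ x₂ ψ) (a : deckGroup D₁ p₁)
    {C : ℝ} {m : M₁} {m' : M₂} (h : Corresponds ψ F₁ F₂ x₁ x₂ C m m') :
    Corresponds ψ F₁ F₂ x₁ x₂ C ((a : M₁ ≃ₜ M₁) m) ((ψ a : M₂ ≃ₜ M₂) m') := by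
  obtain ⟨g, hg⟩ := h
  -- `Fⁿ a = φⁿ(a) Fⁿ`, and `ψ` intertwines the powers of the induced automorphisms.
  have key : ∀ n : ℤ, ∃ b : deckGroup D₁ p₁,
      (∀ m, (F₁ ^ n) ((a : M₁ ≃ₜ M₁) m) = (b : M₁ ≃ₜ M₁) ((F₁ ^ n) m)) ∧
      ∀ m, (F₂ ^ n) ((ψ a : M₂ ≃ₜ M₂) m) = (ψ b : M₂ ≃ₜ M₂) ((F₂ ^ n) m) := by
    intro n
    induction n with
    | zero => exact ⟨a, fun _ => rfl, fun _ => rfl⟩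
    | succ n ih =>
      obtain ⟨b, hb, hb'⟩ := ih
      refine ⟨inducedAut h₁.isLift b, fun m => ?_, fun m => ?_⟩
      · rw [add_comm, zpow_one_add, Homeomorph.mul_apply, Homeomorph.mul_apply, hb,
          inducedAut_apply_apply]
      · rw [add_comm, zpow_one_add, Homeomorph.mul_apply, Homeomorph.mul_apply, hb',
          H.map_inducedAut, inducedAut_apply_apply]
    | pred n ih =>
      obtain ⟨b, hb, hb'⟩ := ih
      have e₁ : ∀ m, F₁ ((F₁ ^ (-(n : ℤ) - 1)) m) = (F₁ ^ (-(n : ℤ))) m := fun m => by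
        rw [← Homeomorph.mul_apply, ← zpow_one_add, add_sub_cancel]
      have e₂ : ∀ m, F₂ ((F₂ ^ (-(n : ℤ) - 1)) m) = (F₂ ^ (-(n : ℤ))) m := fun m => by
        rw [← Homeomorph.mul_apply, ← zpow_one_add, add_sub_cancel]
      obtain ⟨b, rfl⟩ := (inducedAut h₁.isLift).surjective b
      refine ⟨b, fun m => F₁.injective ?_, fun m => F₂.injective ?_⟩
      · rw [e₁, hb, ← inducedAut_apply_apply h₁.isLift, e₁]
      · rw [e₂, hb', ← inducedAut_apply_apply h₂.isLift, e₂, H.map_inducedAut]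
  choose b hb hb' using key
  refine ⟨fun n => b n * g n, fun n => ⟨?_, ?_⟩⟩
  · rw [hb]
    change dist ((b n : M₁ ≃ₜ M₁) ((g n : M₁ ≃ₜ M₁) x₁)) _ ≤ C
    rw [h₁.dist_deck _ (b n).2]
    exact (hg n).1
  · rw [hb', map_mul]
    change dist ((ψ (b n) : M₂ ≃ₜ M₂) ((ψ (g n) : M₂ ≃ₜ M₂) x₂)) _ ≤ C
    rw [h₂.dist_deck _ (ψ (b n)).2]
    exact (hg n).2

variable [CompactSpace X₁] [ProperSpace M₁] [CompactSpace X₂] [ProperSpace M₂]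

/-- If the set `A₂` has the shadowing property and `ψ` coarsely maps the invariant set `A₁` to
`A₂`, then the points of `A₁` correspond to points of `A₂` with a uniform error. -/
theorem exists_corresponds_on (H : SplittingIsomorphism h₁ h₂ x₁ x₂ ψ) {A₁ : Set M₁}
    {A₂ : Set M₂} (hA₁ : ∀ n : ℤ, ∀ y ∈ A₁, (F₁ ^ n) y ∈ A₁)
    (hcoarse : ∃ r : ℝ, ∀ y ∈ A₁, ∃ g : deckGroup D₁ p₁,
      dist ((g : M₁ ≃ₜ M₁) x₁) y ≤ r ∧ ∃ z ∈ A₂, dist ((ψ g : M₂ ≃ₜ M₂) x₂) z ≤ r)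
    (hshadow : ∀ c : ℝ, ∃ C : ℝ, ∀ z : ℤ → M₂, (∀ n, z n ∈ A₂) →
      (∀ n, dist (F₂ (z n)) (z (n + 1)) ≤ c) → ∃ w ∈ A₂, ∀ n, dist ((F₂ ^ n) w) (z n) ≤ C) :
    ∃ C : ℝ, ∀ y ∈ A₁, ∃ w ∈ A₂, Corresponds ψ F₁ F₂ x₁ x₂ C y w := by
  obtain ⟨r, hr⟩ := hcoarse
  obtain ⟨c₁, -, hc₁⟩ := h₁.exists_dist_lift_le r
  obtain ⟨c₂, -, hc₂⟩ := h₂.exists_dist_lift_le r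
  obtain ⟨K, hK⟩ := h₁.exists_dist_deck_le h₂ x₁ x₂ ψ (c₁ + r)
  obtain ⟨C, hC⟩ := hshadow (c₂ + K + r)
  refine ⟨max r (r + C), fun y hy => ?_⟩
  choose g hg z hzA hz using fun n : ℤ => hr _ (hA₁ n y hy)
  obtain ⟨w, hw, hwz⟩ := hC z hzA fun n => by
    have i₁ := hc₁ _ _ (hg n)
    have i₂ := hc₂ _ _ (hz n)
    rw [← inducedAut_apply_apply h₁.isLift, H.fixed₁, ← Homeomorph.mul_apply, ← zpow_one_add,
      add_comm] at i₁
    rw [← inducedAut_apply_apply h₂.isLift, H.fixed₂, ← H.map_inducedAut, dist_comm] at i₂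
    have i₃ := hK _ (g (n + 1)) ((dist_triangle_right _ _ ((F₁ ^ (n + 1)) y)).trans
      (add_le_add i₁ (hg (n + 1))))
    exact (dist_triangle4 _ _ _ _).trans (add_le_add (add_le_add i₂ i₃) (hz (n + 1)))
  refine ⟨w, hw, g, fun n => ⟨(hg n).trans (le_max_left _ _), ?_⟩⟩
  have i := hwz n
  rw [dist_comm] at i
  exact ((dist_triangle _ _ _).trans (add_le_add (hz n) i)).trans (le_max_right _ _)

/-- Every point corresponds to a point, and the correspondence is continuous. -/
theorem exists_map (H : SplittingIsomorphism h₁ h₂ x₁ x₂ ψ) :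
    ∃ T : M₁ → M₂, Continuous T ∧ ∀ m, ∃ C, Corresponds ψ F₁ F₂ x₁ x₂ C m (T m) := by
  have hinv₁ : ∀ n : ℤ, ∀ y ∈ D₁.plaque₁ x₁, (F₁ ^ n) y ∈ D₁.plaque₁ x₁ := by
    intro n y hy
    have := h₁.br_zpow n x₁ y
    rw [HyperbolicSplitting.zpow_apply_eq_self H.fixed₁, show D₁.br x₁ y = x₁ from hy,
      HyperbolicSplitting.zpow_apply_eq_self H.fixed₁] at this
    exact this.symm
  have hinv₂ : ∀ n : ℤ, ∀ y ∈ D₁.plaque₂ x₁, (F₁ ^ n) y ∈ D₁.plaque₂ x₁ := by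
    intro n y hy
    have := h₁.br_zpow n x₁ y
    rw [HyperbolicSplitting.zpow_apply_eq_self H.fixed₁, show D₁.br x₁ y = y from hy] at this
    exact this.symm
  obtain ⟨C₁, hC₁⟩ := H.exists_corresponds_on hinv₁ H.plaque₁ (h₂.exists_shadow₁ H.fixed₂)
  obtain ⟨C₂, hC₂⟩ := H.exists_corresponds_on hinv₂ H.plaque₂ (h₂.exists_shadow₂ H.fixed₂)
  have hmem₂ : ∀ m, D₁.br x₁ m ∈ D₁.plaque₂ x₁ := fun m => D₁.br_br_right x₁ x₁ m
  have htotal : ∀ m, ∃ m', ∃ C, Corresponds ψ F₁ F₂ x₁ x₂ C m m' := by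
    intro m
    obtain ⟨y', -, hy'⟩ := hC₁ _ (D₁.br_mem_plaque₁ m x₁)
    obtain ⟨z', -, hz'⟩ := hC₂ _ (hmem₂ m)
    obtain ⟨K, hK⟩ := h₁.corresponds_br h₂ hy' hz'
    rw [D₁.br_proj] at hK
    exact ⟨_, K, hK⟩
  choose T K hT using htotal
  refine ⟨T, ?_, fun m => ⟨K m, hT m⟩⟩
  have hT₁ : ContinuousOn T (D₁.plaque₁ x₁) := by
    refine h₁.continuousOn_of_corresponds h₂ (x₁ := x₁) (x₂ := x₂) (ψ := ψ)
      (A₂ := D₂.plaque₁ x₂) (C := C₁) ?_ ?_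
    · intro r ε hε
      obtain ⟨N, hN⟩ := h₂.exists_dist_le_of_zpow_neg r hε
      exact ⟨-(N : ℤ), fun y hy z hz => hN N le_rfl y z
        (D₂.br_left_trans (D₂.br_eq_left_iff.1 hy) hz)⟩
    · intro y hy
      obtain ⟨w, hw, hyw⟩ := hC₁ y hy
      rw [h₁.corresponds_unique h₂ (hT y) hyw]
      exact ⟨hw, hyw⟩
  have hT₂ : ContinuousOn T (D₁.plaque₂ x₁) := by
    refine h₁.continuousOn_of_corresponds h₂ (x₁ := x₁) (x₂ := x₂) (ψ := ψ)
      (A₂ := D₂.plaque₂ x₂) (C := C₂) ?_ ?_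
    · intro r ε hε
      obtain ⟨N, hN⟩ := h₂.exists_dist_le_of_zpow r hε
      refine ⟨N, fun y hy z hz => hN N le_rfl y z ?_⟩
      rw [← show D₂.br x₂ z = z from hz, D₂.br_br_right, ← D₂.br_br_left x₂ y z,
        show D₂.br x₂ y = y from hy]
    · intro y hy
      obtain ⟨w, hw, hyw⟩ := hC₂ y hy
      rw [h₁.corresponds_unique h₂ (hT y) hyw]
      exact ⟨hw, hyw⟩
  have hTbr : ∀ m, T m = D₂.br (T (D₁.br m x₁)) (T (D₁.br x₁ m)) := by
    intro m
    obtain ⟨K', hK'⟩ := h₁.corresponds_br h₂ (hT (D₁.br m x₁)) (hT (D₁.br x₁ m))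
    rw [D₁.br_proj] at hK'
    exact h₁.corresponds_unique h₂ (hT m) hK'
  have hbr₁ := D₁.continuous_br
  have c₁ : Continuous fun m => T (D₁.br m x₁) :=
    hT₁.comp_continuous (by fun_prop) fun m => D₁.br_mem_plaque₁ m x₁
  have c₂ : Continuous fun m => T (D₁.br x₁ m) := hT₂.comp_continuous (by fun_prop) hmem₂
  rw [show T = fun m => D₂.br (T (D₁.br m x₁)) (T (D₁.br x₁ m)) from funext hTbr]
  exact D₂.continuous_br.comp (c₁.prodMk c₂)

/-- The correspondence descends to a continuous map between the bases of the coverings. -/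
theorem exists_base_map (H : SplittingIsomorphism h₁ h₂ x₁ x₂ ψ) {T : M₁ → M₂}
    (hTc : Continuous T) (hT : ∀ m, ∃ C, Corresponds ψ F₁ F₂ x₁ x₂ C m (T m)) :
    ∃ k : X₁ → X₂, Continuous k ∧ ∀ m, k (p₁ m) = p₂ (T m) := by
  have key : ∀ m m', p₁ m = p₁ m' → p₂ (T m) = p₂ (T m') := by
    intro m m' hmm'
    obtain ⟨g, hg, rfl⟩ := h₁.exists_deck_apply_eq hmm'
    obtain ⟨C, hC⟩ := hT m
    obtain ⟨C', hC'⟩ := hT (g m)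
    rw [h₁.corresponds_unique h₂ hC' (H.corresponds_deck ⟨g, hg⟩ hC), (ψ ⟨g, hg⟩).2.2]
  have hk : ∀ m, p₂ (T (Function.surjInv h₁.surjective (p₁ m))) = p₂ (T m) := fun m =>
    key _ _ (Function.surjInv_eq h₁.surjective _)
  refine ⟨fun q => p₂ (T (Function.surjInv h₁.surjective q)), ?_, hk⟩
  rw [(h₁.isCoveringMap.isQuotientMap h₁.surjective).continuous_iff]
  exact (h₂.isCoveringMap.continuous.comp hTc).congr fun m => (hk m).symm

/-- The correspondences defined by `ψ` and by its inverse are inverse to each other, and they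
descend to a conjugacy. -/
theorem exists_conjugacy (H : SplittingIsomorphism h₁ h₂ x₁ x₂ ψ) :
    ∃ k : X₁ ≃ₜ X₂, ∀ q, k (f₁ q) = f₂ (k q) := by
  obtain ⟨T, hTc, hT⟩ := H.exists_map
  obtain ⟨S, hSc, hS⟩ := H.symm.exists_map
  obtain ⟨k, hkc, hk⟩ := H.exists_base_map hTc hT
  obtain ⟨l, hlc, hl⟩ := H.symm.exists_base_map hSc hS
  have hST : ∀ m, S (T m) = m := fun m => by
    obtain ⟨C, hC⟩ := hT m
    obtain ⟨C', hC'⟩ := hS (T m)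
    exact h₂.corresponds_unique h₁ hC' hC.symm
  have hTS : ∀ m, T (S m) = m := fun m => by
    obtain ⟨C, hC⟩ := hS m
    obtain ⟨C', hC'⟩ := hT (S m)
    exact h₁.corresponds_unique h₂ hC' hC.symm
  refine ⟨⟨⟨k, l, fun q => ?_, fun q => ?_⟩, hkc, hlc⟩, fun q => ?_⟩
  · obtain ⟨m, rfl⟩ := h₁.surjective q
    rw [hk, hl, hST]
  · obtain ⟨m, rfl⟩ := h₂.surjective q
    rw [hl, hk, hTS]
  · obtain ⟨m, rfl⟩ := h₁.surjective q
    change k (f₁ (p₁ m)) = f₂ (k (p₁ m))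
    obtain ⟨C, hC⟩ := hT m
    obtain ⟨C', hC'⟩ := hT (F₁ m)
    rw [← h₁.isLift.semiconj, hk, hk, h₁.corresponds_unique h₂ hC' hC.lift,
      h₂.isLift.semiconj]

end SplittingIsomorphism

end

/-! ### Smale spaces as hyperbolic splittings -/

/-- In a locally connected space, every point of a rectangle has arbitrarily small connected
subrectangles. -/
theorem Rectangle.exists_isPreconnected_subset {X : Type*} [TopologicalSpace X]
    [LocallyConnectedSpace X] (R : Rectangle X) {x : X} (hx : x ∈ R.carrier) {O : Set X}
    (hO : O ∈ 𝓝 x) : ∃ T : Rectangle X, T.br = R.br ∧ x ∈ T.carrier ∧ T.carrier ⊆ R.carrier ∧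
      T.carrier ⊆ O ∧ IsPreconnected T.carrier := by
  have hcont : ∀ {u v : X}, u ∈ R.carrier → v ∈ R.carrier →
      ContinuousAt (fun q : X × X => R.br q.1 q.2) (u, v) := fun hu hv =>
    R.continuousOn_br.continuousAt
      ((R.isOpen_carrier.prod R.isOpen_carrier).mem_nhds ⟨hu, hv⟩)
  have hbrx : (fun q : X × X => R.br q.1 q.2) ⁻¹' O ∈ 𝓝 (x, x) :=
    hcont hx hx (by simpa only [R.br_self x hx] using hO)
  obtain ⟨W, hW, hxW, hWO⟩ : ∃ W, IsOpen W ∧ x ∈ W ∧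
      ∀ u ∈ W, ∀ v ∈ W, R.br u v ∈ O := by
    obtain ⟨u, hu, v, hv, huv⟩ := mem_nhds_prod_iff.1 hbrx
    refine ⟨interior (u ∩ v), isOpen_interior, mem_interior_iff_mem_nhds.2 (inter_mem hu hv),
      fun a ha b hb => huv (mk_mem_prod (interior_subset ha).1 (interior_subset hb).2)⟩
  -- The subrectangle consists of all brackets of points of a connected open set `C`.
  set C := connectedComponentIn (R.carrier ∩ W) x with hC
  have hCo : IsOpen C := (R.isOpen_carrier.inter hW).connectedComponentIn
  have hxC : x ∈ C := mem_connectedComponentIn ⟨hx, hxW⟩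
  have hCc : IsPreconnected C := isPreconnected_connectedComponentIn
  have hCR : ∀ {u}, u ∈ C → u ∈ R.carrier := fun hu => (connectedComponentIn_subset _ _ hu).1
  have hCW : ∀ {u}, u ∈ C → u ∈ W := fun hu => (connectedComponentIn_subset _ _ hu).2
  set S := (fun q : X × X => R.br q.1 q.2) '' (C ×ˢ C) with hS
  have hSR : S ⊆ R.carrier := by
    rintro _ ⟨q, hq, rfl⟩
    exact R.br_mem _ (hCR hq.1) _ (hCR hq.2)
  have hSo : IsOpen S := by
    rw [isOpen_iff_mem_nhds]
    rintro _ ⟨⟨c, c'⟩, ⟨hc, hc'⟩, rfl⟩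
    simp only at hc hc' ⊢
    have hw := R.br_mem _ (hCR hc) _ (hCR hc')
    have e₁ : ∀ᶠ w in 𝓝 (R.br c c'), R.br w c ∈ C := by
      have h1 : ContinuousAt (fun w => R.br w c) (R.br c c') :=
        (hcont hw (hCR hc)).comp (f := fun w => (w, c)) (by fun_prop)
      refine h1 (hCo.mem_nhds ?_)
      change R.br (R.br c c') c ∈ C
      rwa [R.br_br_left _ (hCR hc) _ (hCR hc') _ (hCR hc), R.br_self _ (hCR hc)]
    have e₂ : ∀ᶠ w in 𝓝 (R.br c c'), R.br c' w ∈ C := by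
      have h1 : ContinuousAt (fun w => R.br c' w) (R.br c c') :=
        (hcont (hCR hc') hw).comp (f := fun w => (c', w)) (by fun_prop)
      refine h1 (hCo.mem_nhds ?_)
      change R.br c' (R.br c c') ∈ C
      rwa [R.br_br_right _ (hCR hc') _ (hCR hc) _ (hCR hc'), R.br_self _ (hCR hc')]
    filter_upwards [e₁, e₂, R.isOpen_carrier.mem_nhds hw] with w h1 h2 hwR
    refine ⟨(R.br w c, R.br c' w), ⟨h1, h2⟩, ?_⟩
    change R.br (R.br w c) (R.br c' w) = w
    rw [R.br_br_left _ hwR _ (hCR hc) _ (hCR h2), R.br_br_right _ hwR _ (hCR hc') _ hwR,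
      R.br_self _ hwR]
  refine ⟨⟨S, R.br, hSo, ?_, R.continuousOn_br.mono (prod_mono hSR hSR),
    fun u hu => R.br_self u (hSR hu),
    fun u hu v hv w hw => R.br_br_left u (hSR hu) v (hSR hv) w (hSR hw),
    fun u hu v hv w hw => R.br_br_right u (hSR hu) v (hSR hv) w (hSR hw)⟩, rfl,
    ⟨(x, x), ⟨hxC, hxC⟩, R.br_self x hx⟩, hSR, ?_, ?_⟩
  · rintro _ ⟨⟨a, b⟩, ⟨ha, hb⟩, rfl⟩ _ ⟨⟨c, d⟩, ⟨hc, hd⟩, rfl⟩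
    refine ⟨(a, d), ⟨ha, hd⟩, ?_⟩
    change R.br a d = R.br (R.br a b) (R.br c d)
    rw [R.br_br_left _ (hCR ha) _ (hCR hb) _ (hSR ⟨(c, d), ⟨hc, hd⟩, rfl⟩),
      R.br_br_right _ (hCR ha) _ (hCR hc) _ (hCR hd)]
  · rintro _ ⟨q, hq, rfl⟩
    exact hWO _ (hCW hq.1) _ (hCW hq.2)
  · exact (hCc.prod hCc).image _ (R.continuousOn_br.mono fun q hq => ⟨hCR hq.1, hCR hq.2⟩)

/-- Two rectangles of a local product structure agree near every common point. -/
theorem LocalProductStructure.IsSubrectangle.eventually_br_eq {X : Type*} [TopologicalSpace X]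
    {L : LocalProductStructure X} {R S : Rectangle X} (hR : L.IsSubrectangle R)
    (hS : L.IsSubrectangle S) {x : X} (hxR : x ∈ R.carrier) (hxS : x ∈ S.carrier) :
    ∀ᶠ q in 𝓝 (x, x), R.br q.1 q.2 = S.br q.1 q.2 := by
  obtain ⟨T, hT, hxT⟩ := L.covers x
  obtain ⟨U, hU, hRT⟩ := hR T hT x
  obtain ⟨V, hV, hST⟩ := hS T hT x
  have hW := inter_mem (inter_mem hU hV) (inter_mem (R.isOpen_carrier.mem_nhds hxR)
    (inter_mem (S.isOpen_carrier.mem_nhds hxS) (T.isOpen_carrier.mem_nhds hxT)))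
  filter_upwards [prod_mem_nhds hW hW] with q
    ⟨⟨⟨hU₁, hV₁⟩, hR₁, hS₁, hT₁⟩, ⟨hU₂, hV₂⟩, hR₂, hS₂, hT₂⟩
  rw [hRT _ ⟨⟨hU₁, hR₁⟩, hT₁⟩ _ ⟨⟨hU₂, hR₂⟩, hT₂⟩, hST _ ⟨⟨hV₁, hS₁⟩, hT₁⟩ _ ⟨⟨hV₂, hS₂⟩, hT₂⟩]

theorem PreservesLocalProduct.eventually_map_br {X M : Type*} [TopologicalSpace X]
    [TopologicalSpace M] {L : LocalProductStructure X} {D : DirectProductStructure M} {p : M → X}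
    (hp : PreservesLocalProduct D.toLocalProductStructure L p) {T : Rectangle X}
    (hT : L.IsSubrectangle T) {a : M} (ha : p a ∈ T.carrier) :
    ∀ᶠ q in 𝓝 (a, a), p (D.br q.1 q.2) = T.br (p q.1) (p q.2) := by
  obtain ⟨hpc, H⟩ := hp
  obtain ⟨R, hR, haR, S, hS, hSR, hpS⟩ := H a
  have h₁ := LocalProductStructure.IsSubrectangle.eventually_br_eq (S := D.toRectangle) hR
    (by rintro _ rfl x; exact ⟨univ, univ_mem, fun _ _ _ _ => rfl⟩) haR (mem_univ a)
  have h₂ := hS.eventually_br_eq hT (hSR ▸ mem_image_of_mem p haR) ha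
  have hpp : Continuous fun q : M × M => (p q.1, p q.2) := by fun_prop
  have hRn := R.isOpen_carrier.mem_nhds haR
  filter_upwards [h₁, (hpp.tendsto (a, a)).eventually h₂, prod_mem_nhds hRn hRn]
    with q i₁ i₂ i₃
  rw [← i₂, ← hpS _ i₃.1 _ i₃.2, i₁]
  rfl

theorem tendsto_dist_of_mem_stableLeaf {X : Type*} [MetricSpace X] [CompactSpace X] {f : X ≃ₜ X}
    {x y : X} (h : y ∈ stableLeaf f x) :
    Tendsto (fun n : ℕ => dist ((f ^ n) x) ((f ^ n) y)) atTop (𝓝 0) := by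
  have h' : Tendsto (fun n : ℕ => ((f ^ n) x, (f ^ n) y)) atTop (𝓝ˢ (diagonal X)) := h
  rw [nhdsSet_diagonal_eq_uniformity, tendsto_uniformity_iff_dist_tendsto_zero] at h'
  exact h'

section OfIsSplitting

variable {X M : Type*} [MetricSpace X] [CompactSpace X] [LocallyConnectedSpace X]
  {f : X ≃ₜ X} {L : LocalProductStructure X}

/-- The hyperbolicity of `f` with respect to a fixed metric. -/
def IsUniformlyHyperbolic (f : X ≃ₜ X) (L : LocalProductStructure X) : Prop :=
  ∃ lam C : ℝ, 0 < lam ∧ lam < 1 ∧ 0 < C ∧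
    ∀ x : X, ∃ R : Rectangle X, L.IsSubrectangle R ∧ x ∈ R.carrier ∧ ∀ u ∈ R.carrier,
      (∀ n : ℕ, ∀ y ∈ R.plaque₁ u, ∀ z ∈ R.plaque₁ u,
        dist ((f ^ n) y) ((f ^ n) z) ≤ C * lam ^ n * dist y z) ∧
      (∀ n : ℕ, ∀ y ∈ R.plaque₂ u, ∀ z ∈ R.plaque₂ u,
        dist ((f⁻¹ ^ n) y) ((f⁻¹ ^ n) z) ≤ C * lam ^ n * dist y z)

theorem HyperbolicSplitting.of_isSplitting [MetricSpace M] {D : DirectProductStructure M}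
    {p : M → X} {F : M ≃ₜ M} (hf : IsUniformlyHyperbolic f L) (hp : IsSplitting f L D p)
    (hF : IsLift f D p F)
    (hdist : ∀ g ∈ deckGroup D p, ∀ x y : M, dist (g x) (g y) = dist x y) :
    HyperbolicSplitting f D p F := by
  obtain ⟨U, hU, hleaf⟩ := hp.leaves
  refine ⟨hp.isCoveringMap, hp.surjective, hF, hdist, ?_, ?_, ?_, ?_, ?_, ?_, ?_, ?_⟩
  · have hmem := hU.mem_nhds
    rw [nhdsSet_diagonal_eq_uniformity, Metric.mem_uniformity_dist] at hmem
    obtain ⟨ε, hε, hεU⟩ := hmem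
    exact ⟨ε / 2, half_pos hε, fun x y hxy =>
      hU.expansive x y fun n => hεU ((hxy n).trans_lt (half_lt_self hε))⟩
  · intro a b b' hb hb' hbb'
    obtain ⟨h, hh⟩ := (hleaf a).1
    have : h ⟨b, hb⟩ = h ⟨b', hb'⟩ := Subtype.ext (by rw [hh, hh]; exact hbb')
    exact congrArg Subtype.val (h.injective this)
  · intro a b b' hb hb' hbb'
    obtain ⟨h, hh⟩ := (hleaf a).2
    have : h ⟨b, hb⟩ = h ⟨b', hb'⟩ := Subtype.ext (by rw [hh, hh]; exact hbb')
    exact congrArg Subtype.val (h.injective this)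
  · intro a b hab
    obtain ⟨h, hh⟩ := (hleaf a).1
    have := tendsto_dist_of_mem_stableLeaf (h ⟨b, hab⟩).2
    rwa [hh] at this
  · intro a b hab
    obtain ⟨h, hh⟩ := (hleaf a).2
    have := tendsto_dist_of_mem_stableLeaf (h ⟨b, hab⟩).2
    rwa [hh] at this
  · intro a a' haa'
    obtain ⟨h, hh⟩ := (hleaf a).1
    obtain ⟨h', hh'⟩ : ∃ h : D.plaque₁ a' ≃ₜ StableLeafSpace f U (p a), ∀ y, (h y).val = p y :=
      haa' ▸ (hleaf a').1
    exact ⟨h.trans h'.symm, fun y => by rw [← hh', ← hh]; simp⟩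
  · intro a a' haa'
    obtain ⟨h, hh⟩ := (hleaf a).2
    obtain ⟨h', hh'⟩ : ∃ h : D.plaque₂ a' ≃ₜ StableLeafSpace f⁻¹ U (p a), ∀ y, (h y).val = p y :=
      haa' ▸ (hleaf a').2
    exact ⟨h.trans h'.symm, fun y => by rw [← hh', ← hh]; simp⟩
  · obtain ⟨lam, C, hlam, hlam1, hC, hcov⟩ := hf
    refine ⟨C, hC, fun x O hO => ?_⟩
    obtain ⟨R, hR, hxR, hest⟩ := hcov x
    obtain ⟨T, hTbr, hxT, hTR, hTO, hTc⟩ := R.exists_isPreconnected_subset hxR hO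
    have hle : ∀ (n : ℕ) (y z : X), C * lam ^ n * dist y z ≤ C * dist y z := fun n y z => by
      have := pow_le_one₀ hlam.le hlam1.le (n := n)
      gcongr
      exact mul_le_of_le_one_right hC.le this
    have hT₁ : ∀ u, T.plaque₁ u ⊆ R.plaque₁ u := fun u v hv => ⟨hTR hv.1, hTbr ▸ hv.2⟩
    have hT₂ : ∀ u, T.plaque₂ u ⊆ R.plaque₂ u := fun u v hv => ⟨hTR hv.1, hTbr ▸ hv.2⟩
    refine ⟨T, ⟨hTc, fun a ha => ?_, fun u hu n y hy z hz => ?_, fun u hu n y hy z hz => ?_⟩,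
      hxT, hTO⟩
    · rw [hTbr]
      exact hp.preserves.eventually_map_br hR (hTR ha)
    · exact ((hest u (hTR hu)).1 n y (hT₁ u hy) z (hT₁ u hz)).trans (hle _ _ _)
    · exact ((hest u (hTR hu)).2 n y (hT₂ u hy) z (hT₂ u hz)).trans (hle _ _ _)

/-- Finite Hausdorff distance does not depend on the choice of the invariant proper metric. -/
theorem FiniteHausdorffDist.exists_dist_le [t : TopologicalSpace M] {D : DirectProductStructure M}
    {p : M → X} {F : M ≃ₜ M} (hf : IsUniformlyHyperbolic f L) (hp : IsSplitting f L D p)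
    (hF : IsLift f D p F) {m m' : MetricSpace M}
    (hm' : @IsInvariantProperMetric X M _ t D p m') {x : M} {S : Set (deckGroup D p)} {A : Set M}
    (hA : FiniteHausdorffDist m' (@partialOrbit X M t D p S x) A)
    (hm : @IsInvariantProperMetric X M _ t D p m) :
    ∃ r : ℝ, (∀ g ∈ S, ∃ z ∈ A, m.dist ((g : M ≃ₜ M) x) z ≤ r) ∧
      ∀ y ∈ A, ∃ g ∈ S, m.dist ((g : M ≃ₜ M) x) y ≤ r := by
  obtain ⟨rfl, hproper, hinv⟩ := hm'
  obtain ⟨r, h₁, h₂⟩ := hA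
  obtain ⟨C, -, hC⟩ := @HyperbolicSplitting.exists_dist_le_of_dist_le X _ f _ M m' hproper D p F
    (@HyperbolicSplitting.of_isSplitting X M _ _ _ f L m' D p F hf hp hF hinv) m hm r
  refine ⟨C, fun g hg => ?_, fun y hy => ?_⟩
  · obtain ⟨z, hz, hd⟩ := h₁ _ ⟨g, hg, rfl⟩
    exact ⟨z, hz, hC _ _ hd.le⟩
  · obtain ⟨_, ⟨g, hg, rfl⟩, hd⟩ := h₂ y hy
    exact ⟨g, hg, hC _ _ hd.le⟩

end OfIsSplitting

/-- If every point of `A₁` is near the orbit of `S₁`, the map `ψ` takes `S₁` to `S₂`, and the orbit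
of `S₂` is near `A₂`, then `ψ` coarsely maps `A₁` to `A₂`. -/
theorem exists_coarse_match {M₁ M₂ G₁ G₂ : Type*} [MetricSpace M₁] [MetricSpace M₂]
    {o₁ : G₁ → M₁} {o₂ : G₂ → M₂} {ψ : G₁ → G₂} {S₁ : Set G₁} {S₂ : Set G₂}
    (hS : ∀ g ∈ S₁, ψ g ∈ S₂) {A₁ : Set M₁} {A₂ : Set M₂}
    (h₁ : ∃ r : ℝ, ∀ y ∈ A₁, ∃ g ∈ S₁, dist (o₁ g) y ≤ r)
    (h₂ : ∃ r : ℝ, ∀ g ∈ S₂, ∃ z ∈ A₂, dist (o₂ g) z ≤ r) :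
    ∃ r : ℝ, ∀ y ∈ A₁, ∃ g : G₁, dist (o₁ g) y ≤ r ∧ ∃ z ∈ A₂, dist (o₂ (ψ g)) z ≤ r := by
  obtain ⟨r₁, hr₁⟩ := h₁
  obtain ⟨r₂, hr₂⟩ := h₂
  refine ⟨max r₁ r₂, fun y hy => ?_⟩
  obtain ⟨g, hg, hgy⟩ := hr₁ y hy
  obtain ⟨z, hz, hgz⟩ := hr₂ _ (hS g hg)
  exact ⟨g, hgy.trans (le_max_left _ _), z, hz, hgz.trans (le_max_right _ _)⟩

theorem mainTheorem4
    {X₁ X₂ M₁ M₂ : Type*}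
    [TopologicalSpace X₁] [TopologicalSpace X₂] [TopologicalSpace M₁] [TopologicalSpace M₂]
    [ConnectedSpace X₁] [LocallyConnectedSpace X₁]
    [ConnectedSpace X₂] [LocallyConnectedSpace X₂]
    -- two Smale spaces
    (f₁ : X₁ ≃ₜ X₁) (L₁ : LocalProductStructure X₁) (hf₁ : IsSmaleSpace f₁ L₁)
    (f₂ : X₂ ≃ₜ X₂) (L₂ : LocalProductStructure X₂) (hf₂ : IsSmaleSpace f₂ L₂)
    -- their splittings
    (D₁ : DirectProductStructure M₁) (p₁ : M₁ → X₁) (hp₁ : IsSplitting f₁ L₁ D₁ p₁)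
    (D₂ : DirectProductStructure M₂) (p₂ : M₂ → X₂) (hp₂ : IsSplitting f₂ L₂ D₂ p₂)
    -- lifts with fixed points
    (F₁ : M₁ ≃ₜ M₁) (hF₁ : IsLift f₁ D₁ p₁ F₁) (x₁ : M₁) (hx₁ : F₁ x₁ = x₁)
    (F₂ : M₂ ≃ₜ M₂) (hF₂ : IsLift f₂ D₂ p₂ F₂) (x₂ : M₂) (hx₂ : F₂ x₂ = x₂)
    -- coarse stable and unstable plaques
    (Sp₁ Sm₁ : Set (deckGroup D₁ p₁))
    (hSp₁ : IsCoarseStablePlaque D₁ p₁ x₁ Sp₁) (hSm₁ : IsCoarseUnstablePlaque D₁ p₁ x₁ Sm₁)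
    (Sp₂ Sm₂ : Set (deckGroup D₂ p₂))
    (hSp₂ : IsCoarseStablePlaque D₂ p₂ x₂ Sp₂) (hSm₂ : IsCoarseUnstablePlaque D₂ p₂ x₂ Sm₂)
    -- an isomorphism of the two quadruples
    (ψ : deckGroup D₁ p₁ ≃* deckGroup D₂ p₂)
    (hψ : ∀ g, ψ (inducedAut hF₁ g) = inducedAut hF₂ (ψ g))
    (hψp : ψ '' Sp₁ = Sp₂) (hψm : ψ '' Sm₁ = Sm₂) :
    ∃ h : X₁ ≃ₜ X₂, ∀ x, h (f₁ x) = f₂ (h x) := by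
  obtain ⟨hcompact₁, -, mX₁, rfl, hhyp₁⟩ := hf₁
  obtain ⟨hcompact₂, -, mX₂, rfl, hhyp₂⟩ := hf₂
  obtain ⟨m₁, hm₁, hfin₁⟩ := hSp₁
  obtain ⟨m₁', hm₁', hfin₁'⟩ := hSm₁
  obtain ⟨m₂, hm₂, hfin₂⟩ := hSp₂
  obtain ⟨m₂', hm₂', hfin₂'⟩ := hSm₂
  obtain ⟨r₁, a₁, b₁⟩ := hfin₁.exists_dist_le hhyp₁ hp₁ hF₁ hm₁ hm₁
  obtain ⟨r₁', a₁', b₁'⟩ := hfin₁'.exists_dist_le hhyp₁ hp₁ hF₁ hm₁' hm₁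
  obtain ⟨r₂, a₂, b₂⟩ := hfin₂.exists_dist_le hhyp₂ hp₂ hF₂ hm₂ hm₂
  obtain ⟨r₂', a₂', b₂'⟩ := hfin₂'.exists_dist_le hhyp₂ hp₂ hF₂ hm₂' hm₂
  -- From now on the two spaces carry the metrics `m₁` and `m₂`.
  clear hfin₁ hfin₁' hfin₂ hfin₂' hm₁' hm₂' m₁' m₂'
  obtain ⟨rfl, hproper₁, hinv₁⟩ := hm₁
  obtain ⟨rfl, hproper₂, hinv₂⟩ := hm₂
  have h₁ := HyperbolicSplitting.of_isSplitting hhyp₁ hp₁ hF₁ hinv₁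
  have h₂ := HyperbolicSplitting.of_isSplitting hhyp₂ hp₂ hF₂ hinv₂
  subst hψp hψm
  have hsymm : ∀ S : Set (deckGroup D₁ p₁), ∀ g ∈ ψ '' S, ψ.symm g ∈ S := by
    rintro S _ ⟨g, hg, rfl⟩
    rwa [ψ.symm_apply_apply]
  have H : SplittingIsomorphism h₁ h₂ x₁ x₂ ψ :=
    { fixed₁ := hx₁
      fixed₂ := hx₂
      map_inducedAut := hψ
      plaque₁ := exists_coarse_match (fun g hg => mem_image_of_mem ψ hg) ⟨r₁, b₁⟩ ⟨r₂, a₂⟩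
      plaque₂ := exists_coarse_match (fun g hg => mem_image_of_mem ψ hg) ⟨r₁', b₁'⟩ ⟨r₂', a₂'⟩
      symm_plaque₁ := exists_coarse_match (hsymm Sp₁) ⟨r₂, b₂⟩ ⟨r₁, a₁⟩
      symm_plaque₂ := exists_coarse_match (hsymm Sm₁) ⟨r₂', b₂'⟩ ⟨r₁', a₁'⟩ }
  exact H.exists_conjugacy
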